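/- Let $F$ be a global function field with exact constant field $\mathbb F_q$, let $E'|F$ be a finite abelian extension, and let $F'$ be an intermediate field such that $F'|F$ is a constant field extension, i.e. $F'$ is generated over $F$ by elements algebraic over $\mathbb F_q$. Let $\varphi\in\mathrm{Gal}(F'|F)$ be the Frobenius automorphism, i.e. the automorphism acting as $c\mapsto c^q$ on the exact constant field $\mathbb F_{q^r}$ of $F'$. Let $n$ be a positive integer coprime to $q$ such that $F'$ contains the group $\mu_n$ of $n$-th roots of unity (of order $n$), and suppose that $E'|F'$ is cyclic of order dividing $n$. Let $\mathfrak m$ be an effective divisor of $F$ such that $E'|F$ is unramified outside the support of $\mathfrak m$, and let $D$ be a divisor of $F$ with support disjoint from that of $\mathfrak m$. Notation. The Artin map is $\mathrm{Frob}_{E'|F}(D)=\prod_{\mathfrak p}\sigma_{\mathfrak p}^{\mathrm{ord}_{\mathfrak p}(D)}$, where for a place $\mathfrak p$ of $F$ unramified in $E'$ the automorphism $\sigma_{\mathfrak p}\in\mathrm{Gal}(E'|F)$ is the one with $\sigma_{\mathfrak p}(x)\equiv x^{\#(\mathcal O_{\mathfrak p}/\mathfrak p)} \bmod \mathfrak q$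 for all places $\mathfrak q$ of $E'$ above $\mathfrak p$ and all $x\in\mathcal O_{\mathfrak q}$. $\mathrm{Con}(D)$ is the conorm of $D$ in $F'$. A function $f\in F'^\times$ is coprime to a divisor $A$ of $F'$ if $\mathrm{ord}_{\mathfrak p}(f)=0$ for all $\mathfrak p\in\mathrm{supp}(A)$, and then $f(A)=\prod_{\mathfrak p\in\mathrm{supp}(A)} N_{F'_{\mathfrak p}|\mathbb F_{q^r}}(f_{\mathfrak p})^{\mathrm{ord}_{\mathfrak p}(A)}$, where $f_{\mathfrak p}$ is the image of $f$ in the residue class field $F'_{\mathfrak p}$. Finally, $F'_{n,\mathfrak m}$ is the group of all $f\in F'^\times$ with $n\mid\mathrm{ord}_{\mathfrak p}(f)$ for all places $\mathfrak p$ of $F'$ not lying above $\mathrm{supp}(\mathfrak m)$. Then: (1) There is $\sigma\in\mathrm{Gal}(E'|F)$ extending $\varphi$, and there is $y\in E'$ with $E'=F'(y)$ such that $y^n\in F'_{n,\mathfrak m}$ and $y^n$ is coprime to $\mathrm{Con}(D)$. (2) For all such $\sigma$ and $y$, the element $h=\sigma^{-1}(y)^q\,y^{-1}$ lies in $F'^\times$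 and is coprime to $\mathrm{Con}(D)$, one has $h(\mathrm{Con}(D))\in\mu_n$, there is a unique $\tau_D\in\mathrm{Gal}(E'|F')$ with $\tau_D(y)\,y^{-1}=h(\mathrm{Con}(D))$, and $$\mathrm{Frob}_{E'|F}(D)=\tau_D\circ\sigma^{\deg D}.$$ -/

import Mathlib

noncomputable section

namespace GlobalFunctionField

open IsLocalRing

/-- `F` is a global function field with exact constant field `k`: `k` is finite, `F` is a finite
extension of `k(x)` for some `x` transcendental over `k`, and `k` is algebraically closed in `F`. -/
structure IsGlobalFunctionField (k F : Type*) [Field k] [Field F] [Algebra k F] : Prop where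
  finite_base : Finite k
  exists_finite : ∃ x : F, Transcendental k x ∧
    FiniteDimensional (IntermediateField.adjoin k ({x} : Set F)) F
  algebraicClosure_eq_bot : algebraicClosure k F = ⊥

/-- A place of `L` over `k`, given by its valuation ring: a proper valuation subring of `L`
containing `k`. -/
def Place (k L : Type*) [Field k] [Field L] [Algebra k L] : Type _ :=
  {O : ValuationSubring L // O ≠ ⊤ ∧ ∀ c : k, algebraMap k L c ∈ O}

section Places

variable {k L : Type*} [Field k] [Field L] [Algebra k L]

namespace Place

/-- The valuation ring `O_P` of the place `P`. -/
def ring (P : Place k L) : ValuationSubring L := P.1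

/-- Elements of `L` that are algebraic over `k` lie in every valuation ring `O_P`. -/
theorem const_mem (P : Place k L) (c : algebraicClosure k L) : (c : L) ∈ P.ring := by
  have hint : IsIntegral k (c : L) := (mem_algebraicClosure_iff.1 c.2).isIntegral
  obtain ⟨p, hp, hc⟩ := hint
  let f : k →+* P.ring := (algebraMap k L).codRestrict P.ring P.2.2
  have h2 : IsIntegral P.ring (c : L) := by
    refine ⟨p.map f, hp.map f, ?_⟩
    rw [Polynomial.eval₂_map]
    exact hc
  obtain ⟨y, hy⟩ := IsIntegrallyClosed.isIntegral_iff.1 h2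
  rw [← hy]
  exact y.2

instance instAlgebra (P : Place k L) : Algebra k P.ring :=
  ((algebraMap k L).codRestrict P.ring P.2.2).toAlgebra

instance instAlgebraConst (P : Place k L) : Algebra (algebraicClosure k L) P.ring :=
  ((algebraMap (algebraicClosure k L) L).codRestrict P.ring P.const_mem).toAlgebra

/-- The residue class field `L_P = O_P / P`. -/
abbrev residueField (P : Place k L) : Type _ := ResidueField P.ring

/-- The degree `[L_P : k]` of a place. -/
def deg (P : Place k L) : ℕ := Module.finrank k P.residueField

/-- The absolute norm `N(P) = #(O_P / P)`. -/
def absNorm (P : Place k L) : ℕ := Nat.card P.residueField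

/-- `ord_P(f) = i` means `f = t ^ i * u` with `t` a uniformizer (a generator of the maximal ideal,
equivalently an irreducible element of `O_P`) and `u` a unit of `O_P`. -/
def IsOrd (P : Place k L) (f : L) (i : ℤ) : Prop :=
  ∃ t : P.ring, Irreducible t ∧ ∃ u : (P.ring)ˣ, f = (t : L) ^ i * ((u : P.ring) : L)

open Classical in
/-- The order of `f` at `P`, with the convention `ord_P(0) = 0`; the value at `0` is never used. -/
def ord (P : Place k L) (f : L) : ℤ :=
  if f = 0 then 0 else Classical.epsilon (P.IsOrd f)

open Classical in
/-- The image `f_P` of `f ∈ O_P` in the residue class field (and `0` for `f ∉ O_P`). -/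
def residue (P : Place k L) (f : L) : P.residueField :=
  if h : f ∈ P.ring then IsLocalRing.residue P.ring ⟨f, h⟩ else 0

end Place

/-- Divisors: the free abelian group on the places. -/
abbrev Divisor (k L : Type*) [Field k] [Field L] [Algebra k L] : Type _ := Place k L →₀ ℤ

/-- The degree of a divisor. -/
def Divisor.deg (D : Divisor k L) : ℤ := D.sum fun P i => i * (P.deg : ℤ)

/-- The group of divisors whose support is disjoint from that of `m`. -/
def divisorsAway (m : Divisor k L) : AddSubgroup (Divisor k L) where
  carrier := {D | ∀ P ∈ m.support, D P = 0}
  zero_mem' := fun _ _ => rfl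
  add_mem' := fun {a b} ha hb P hP => by simp [ha P hP, hb P hP]
  neg_mem' := fun {a} ha P hP => by simp [ha P hP]

/-- `f` is a nonzero function whose principal divisor has support disjoint from that of `D`. -/
def IsCoprimeTo (f : L) (D : Divisor k L) : Prop :=
  f ≠ 0 ∧ ∀ P ∈ D.support, P.ord f = 0

/-- The evaluation `f(D) = ∏_P N(f_P) ^ ord_P(D)` of a function at a divisor, where `N` is the norm
from the residue class field of `P` to the exact constant field of `L`. -/
def evalAt (f : L) (D : Divisor k L) : algebraicClosure k L :=
  D.prod fun P i => (Algebra.norm (algebraicClosure k L) (P.residue f)) ^ i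

end Places

section Extensions

variable {k L L' : Type*} [Field k] [Field L] [Field L'] [Algebra k L] [Algebra k L'] [Algebra L L']

/-- The place `Q` of `L'` lies above the place `P` of `L`. -/
def Place.IsAbove (Q : Place k L') (P : Place k L) : Prop :=
  Q.ring.comap (algebraMap L L') = P.ring

/-- The ramification index `e(Q|P)` for `Q` above `P`: the natural number `e` with
`ord_Q(x) = e * ord_P(x)` for all `x ∈ L`. -/
def ramIndex (Q : Place k L') (P : Place k L) : ℕ :=
  Classical.epsilon fun e : ℕ => ∀ x : L, x ≠ 0 → Q.ord (algebraMap L L' x) = e * P.ord x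

variable (L') in
/-- The conorm of a divisor: the additive map with `P ↦ ∑_{Q above P} e(Q|P) Q`. -/
def conorm (D : Divisor k L) : Divisor k L' :=
  D.sum fun P i => i • ∑ᶠ Q : {Q : Place k L' // Q.IsAbove P},
    Finsupp.single Q.1 (ramIndex Q.1 P : ℤ)

variable (L') in
/-- `L'|L` is unramified at all places outside the support of `m`. -/
def IsUnramifiedOutside (m : Divisor k L) : Prop :=
  ∀ P ∉ m.support, ∀ Q : Place k L', Q.IsAbove P → ramIndex Q P = 1

variable (L') in
/-- The generalized Selmer group `L'_{n,S}` for a set `S` of places of `L`, as a subset of `L'`: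
nonzero functions whose order is divisible by `n` at all places of `L'` not lying above `S`. -/
def selmer (n : ℕ) (S : Set (Place k L)) : Set L' :=
  {f | f ≠ 0 ∧ ∀ Q : Place k L', (∀ P ∈ S, ¬ Q.IsAbove P) → (n : ℤ) ∣ Q.ord f}

variable (k L L') in
/-- `L'|L` is a constant field extension: `L'` is generated over `L` by constants. -/
def IsConstantExtension : Prop :=
  IntermediateField.adjoin L (algebraicClosure k L' : Set L') = ⊤

variable (k) in
/-- `φ` is the Frobenius automorphism of the constant field extension `L'|L`: it acts on the
constants of `L'` as the `#k`-power map. -/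
def IsFrobenius (φ : L' ≃ₐ[L] L') : Prop :=
  ∀ c ∈ algebraicClosure k L', φ c = c ^ Nat.card k

/-- `σ` is the Frobenius at `P`: `σ(x) ≡ x ^ N(P) mod Q` for all `x ∈ O_Q` and all `Q` above `P`. -/
def IsArtinSymbol (P : Place k L) (σ : L' ≃ₐ[L] L') : Prop :=
  ∀ Q : Place k L', Q.IsAbove P → ∀ x ∈ Q.ring, σ x - x ^ P.absNorm ∈ Q.ring.nonunits

variable (L') in
/-- The automorphism `σ_P`; it exists uniquely if `L'|L` is abelian and `P` is unramified. -/
def artinSymbol (P : Place k L) : L' ≃ₐ[L] L' :=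
  Classical.epsilon (IsArtinSymbol P)

open scoped IsMulCommutative in
variable (L') in
/-- The Artin map `D ↦ ∏_P σ_P ^ ord_P(D)` of a finite abelian extension `L'|L`. It is used only
for divisors whose support consists of unramified places. -/
def artinMap [IsAbelianGalois L L'] (D : Divisor k L) : L' ≃ₐ[L] L' :=
  D.prod fun P i => artinSymbol L' P ^ i

end Extensions

section KummerData

variable {k F E : Type*} [Field k] [Field F] [Field E] [Algebra k F] [Algebra k E] [Algebra F E]
  [IsScalarTower k F E]

variable (k) in
/-- `σ ∈ Gal(E|F)` extends the Frobenius automorphism of the constant field extension `F'|F`. -/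
def ExtendsFrobenius (F' : IntermediateField F E) (σ : E ≃ₐ[F] E) : Prop :=
  ∃ φ : F' ≃ₐ[F] F', IsFrobenius k φ ∧ ∀ x : F', σ x = φ x

/-- `y` generates `E` over `F'`, and `y ^ n` lies in `F'`, more precisely in the generalized Selmer
group of `n` and the support of `m`, and is coprime to the conorm of `D`. -/
def IsKummerGenerator (F' : IntermediateField F E) (n : ℕ) (m D : Divisor k F) (y : E) : Prop :=
  IntermediateField.adjoin F' {y} = ⊤ ∧
    ∃ f : F', (f : E) = y ^ n ∧ f ∈ selmer F' n (m.support : Set (Place k F)) ∧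
      IsCoprimeTo f (conorm F' D)

end KummerData

end GlobalFunctionField

end

open GlobalFunctionField

noncomputable section

namespace GlobalFunctionField

open IsLocalRing

/-! Write q = #k, let r be the degree over k of the constant field of F', and put h = σ⁻¹(y)^q / y.
Since `D ↦ σ ^ deg D` and the Artin map are both homomorphisms, the claim splits into one statement
for each place P in the support of D, about τ_P = ρ_P σ^{-d} with ρ_P the Artin symbol of P and d =
deg P. A constant field extension is determined by its action on constants, so ρ_P restricts to φ^d
on F'. Hence τ_P fixes F' and multiplies y by an n-th root of unity c_P. It remains to identify c_P
with the product of the norms N(h_R) over the places R of F' above P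
(`exists_artinSymbol_apply_eq`).

Both are constants, so it suffices to compare them in the residue field of one place Q above P. On
one side, the Artin congruence applied to σ^{-d}(y) gives c_P y ≡ (σ^{-d} y)^{q^d}, and a
telescoping product (`prod_range_frobenius_quotient`) turns this into c_P ≡ ∏_{j<d} (φ^{-j}
h)^{q^j}. On the other side, with g = gcd(d, r), the places above P are φ^j Q for j < g, each of
residue degree d/g over the constants. Writing norms as products of q^r-power conjugates and moving
everything to Q yields the factors (φ^{-i} h)^{q^i} with i = j + r l, j < g, l < d/g. These factors
depend only on i mod d, and i meets each class mod d exactly once (`prod_range_gcd_prod_range`), so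
the two products agree (`residue_prod_norm`).

The generator y comes from Kummer theory, corrected by weak approximation so that y^n has order 0
along Con(D). The remaining work is the theory of places behind this: discreteness, approximation,
transitivity of the Galois action, ramification indices and the existence of Artin symbols. -/

/-- `L` is a function field of one variable over `k` (not necessarily its exact constant field). -/
class IsFunctionField (k L : Type*) [Field k] [Field L] [Algebra k L] : Prop where
  essFiniteType : Algebra.EssFiniteType k L
  exists_isTranscendenceBasis : ∃ x : L, IsTranscendenceBasis k fun _ : Unit => x

/-! ### Function fields of one variable. -/

section FunctionField

variable {k L : Type*} [Field k] [Field L] [Algebra k L]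

/-- In transcendence degree one every transcendental t is already a transcendence basis, and a
finitely generated algebraic extension is finite. -/
theorem finiteDimensional_adjoin_of_transcendental [IsFunctionField k L] {t : L}
    (ht : Transcendental k t) :
    FiniteDimensional (IntermediateField.adjoin k ({t} : Set L)) L := by
  obtain ⟨x, hx⟩ := IsFunctionField.exists_isTranscendenceBasis (k := k) (L := L)
  have h2 : Algebra.EssFiniteType k L := IsFunctionField.essFiniteType
  have h3 : Algebra.EssFiniteType (IntermediateField.adjoin k ({t} : Set L)) L :=
    .of_comp k _ _
  have hti : AlgebraicIndependent k (fun _ : Unit => t) :=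
    algebraicIndependent_unique_type_iff.2 ht
  have htb : IsTranscendenceBasis k (fun _ : Unit => t) :=
    hti.isTranscendenceBasis_of_lift_trdeg_le_of_finite
      (by rw [← hx.lift_cardinalMk_eq_trdeg])
  have halg := htb.isAlgebraic_field
  rw [Set.range_const] at halg
  exact Algebra.finite_of_essFiniteType_of_isAlgebraic

open scoped IntermediateField.algebraAdjoinAdjoin in
theorem IsGlobalFunctionField.isFunctionField (h : IsGlobalFunctionField k L) :
    IsFunctionField k L := by
  obtain ⟨x, hx, hfin⟩ := h.exists_finite
  have h1 : Algebra.EssFiniteType k (IntermediateField.adjoin k ({x} : Set L)) :=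
    IntermediateField.essFiniteType_iff.2
      (IntermediateField.fg_adjoin_of_finite (Set.finite_singleton x))
  refine ⟨.comp k (IntermediateField.adjoin k ({x} : Set L)) L, x, ?_⟩
  have hxi : AlgebraicIndependent k (fun _ : Unit => x) :=
    algebraicIndependent_unique_type_iff.2 hx
  refine hxi.isTranscendenceBasis_iff_isAlgebraic.2 ?_
  rw [Set.range_const]
  exact (IsFractionRing.comap_isAlgebraic_iff (A := Algebra.adjoin k ({x} : Set L))
    (K := IntermediateField.adjoin k ({x} : Set L)) (C := L)).2 inferInstance

theorem IsFunctionField.of_finite {L' : Type*} [Field L'] [Algebra k L'] [Algebra L L']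
    [IsScalarTower k L L'] [FiniteDimensional L L'] [IsFunctionField k L] :
    IsFunctionField k L' := by
  obtain ⟨x, hx⟩ := IsFunctionField.exists_isTranscendenceBasis (k := k) (L := L)
  have : Algebra.EssFiniteType k L := IsFunctionField.essFiniteType
  exact ⟨.comp k L L', algebraMap L L' x, hx.algebraMap_comp⟩

end FunctionField

/-! ### Valuation rings of places are discrete with finite residue field. -/

section Places
variable {k L : Type*} [Field k] [Field L] [Algebra k L] 

namespace Place

variable (P : Place k L)

instance : IsScalarTower k P.ring L := .of_algebraMap_eq fun _ => rfl

theorem transcendental_of_mem_nonunits {x : L} (hx : x ∈ P.ring.nonunits) (hx0 : x ≠ 0) :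
    Transcendental k x := by
  intro h
  have h1 := P.const_mem ⟨x⁻¹, mem_algebraicClosure_iff.2 h.inv⟩
  rcases P.ring.mem_nonunits_iff_or.1 hx with h | h
  · exact hx0 h
  · exact h h1

open scoped IntermediateField.algebraAdjoinAdjoin in
-- Clearing denominators gives a relation with coefficients in k[x]. Modulo x only the constant
-- coefficients survive, so they vanish; dividing the relation by x and repeating kills all
-- coefficients.
theorem linearIndependent_of_quotient {x : P.ring} (hx : Transcendental k (x : L))
    {ι : Type*} (a : ι → P.ring)
    (ha : LinearIndependent k (fun i => Ideal.Quotient.mk (Ideal.span {x}) (a i))) :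
    LinearIndependent (IntermediateField.adjoin k ({(x : L)} : Set L)) (fun i => (a i : L)) := by
  have hx0 : (x : L) ≠ 0 := fun h => hx (h ▸ isAlgebraic_zero)
  rw [← LinearIndependent.iff_fractionRing (Algebra.adjoin k ({(x : L)} : Set L))]
  rw [linearIndependent_iff']
  intro s g hg
  have hp : ∀ i, ∃ p : Polynomial k, Polynomial.aeval (x : L) p = g i := fun i =>
    (Algebra.adjoin_singleton_eq_range_aeval k (x : L)).le (g i).2
  choose p hp using hp
  have key : ∀ m : ℕ, ∀ q : ι → Polynomial k, ∑ i ∈ s, Polynomial.aeval x (q i) * a i = 0 →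
      ∀ i ∈ s, (q i).coeff m = 0 := by
    intro m
    have base : ∀ q : ι → Polynomial k, ∑ i ∈ s, Polynomial.aeval x (q i) * a i = 0 →
        (∀ i ∈ s, (q i).coeff 0 = 0) ∧
        ∑ i ∈ s, Polynomial.aeval x (q i).divX * a i = 0 := by
      intro q hq
      have h1 : x * (∑ i ∈ s, Polynomial.aeval x (q i).divX * a i) +
          ∑ i ∈ s, (q i).coeff 0 • a i = 0 := by
        rw [Finset.mul_sum, ← Finset.sum_add_distrib, ← hq]
        refine Finset.sum_congr rfl fun i _ => ?_
        conv_rhs => rw [← Polynomial.X_mul_divX_add (q i)]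
        rw [map_add, map_mul, Polynomial.aeval_X, Polynomial.aeval_C, Algebra.smul_def]
        ring
      have h2 : ∀ i ∈ s, (q i).coeff 0 = 0 := by
        refine linearIndependent_iff'.1 ha s (fun i => (q i).coeff 0) ?_
        have h3 := congrArg (Ideal.Quotient.mk (Ideal.span {x})) h1
        have h4 : Ideal.Quotient.mk (Ideal.span {x}) x = 0 :=
          Ideal.Quotient.eq_zero_iff_mem.2 (Ideal.mem_span_singleton_self x)
        rw [map_add, map_mul, h4, zero_mul, zero_add, map_sum, map_zero] at h3
        exact h3
      refine ⟨h2, ?_⟩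
      have h6 : ∑ i ∈ s, (q i).coeff 0 • a i = 0 :=
        Finset.sum_eq_zero fun i hi => by rw [h2 i hi, zero_smul]
      rw [h6, add_zero] at h1
      exact (mul_eq_zero.1 h1).resolve_left (fun h => hx0 (by simp [h]))
    induction m with
    | zero => exact fun q hq => (base q hq).1
    | succ m ih =>
      intro q hq i hi
      have := ih (fun i => (q i).divX) (base q hq).2 i hi
      rwa [Polynomial.coeff_divX] at this
  have h0 : ∑ i ∈ s, Polynomial.aeval x (p i) * a i = 0 := by
    apply Subtype.val_injective
    have h5 : ∀ q : Polynomial k, ((Polynomial.aeval x q : P.ring) : L)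
        = Polynomial.aeval (x : L) q := fun q =>
      (Polynomial.aeval_algebraMap_apply L x q).symm
    rw [← ValuationSubring.subtype_apply, map_sum]
    simp only [map_mul, ValuationSubring.subtype_apply, h5, hp]
    simpa [Algebra.smul_def] using hg
  intro i hi
  have : p i = 0 := Polynomial.ext fun m => by simpa using key m p h0 i hi
  apply Subtype.val_injective
  rw [← hp i, this]
  simp

/-- A k-basis of the quotient lifts to a family independent over k(x), and L is finite over k(x).
This finiteness is what makes the valuation ring Noetherian, hence discrete. -/
theorem finite_quotient [Finite k] [IsFunctionField k L] {x : P.ring} (hx : x ≠ 0) :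
    Finite (P.ring ⧸ Ideal.span {x}) := by
  by_cases hu : IsUnit x
  · rw [Ideal.span_singleton_eq_top.2 hu]
    exact Finite.of_subsingleton
  have ht : Transcendental k (x : L) := P.transcendental_of_mem_nonunits
    (P.ring.coe_mem_nonunits_iff.2 ((mem_maximalIdeal x).2 hu)) (by simpa using hx)
  have := finiteDimensional_adjoin_of_transcendental ht
  let b := Module.Basis.ofVectorSpace k (P.ring ⧸ Ideal.span {x})
  choose a ha using fun i => Ideal.Quotient.mk_surjective (b i)
  have hli := P.linearIndependent_of_quotient ht a (by simpa [ha] using b.linearIndependent)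
  have hf := hli.finite
  have := Module.Finite.of_basis b
  exact Module.finite_of_finite k

instance [Finite k] [IsFunctionField k L] : IsNoetherianRing P.ring := by
  refine ⟨fun I => ?_⟩
  by_cases hI : I = ⊥
  · exact hI ▸ Submodule.fg_bot
  obtain ⟨x, hxI, hx⟩ := Submodule.exists_mem_ne_zero_of_ne_bot hI
  have := P.finite_quotient hx
  refine Submodule.fg_of_fg_map_of_fg_inf_ker (Ideal.span {x}).mkQ ?_ ?_
  · exact Submodule.FG.of_finite
  · rw [Submodule.ker_mkQ, inf_eq_right.2 ((Ideal.span_singleton_le_iff_mem I).2 hxI)]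
    exact Submodule.fg_span_singleton x

theorem not_isField : ¬ IsField P.ring := fun h => P.2.1 <| by
  refine top_unique fun x _ => ?_
  rcases P.ring.mem_or_inv_mem x with hx | hx
  · exact hx
  · by_cases h0 : x = 0
    · exact h0 ▸ P.ring.zero_mem
    obtain ⟨y, hy⟩ := h.mul_inv_cancel (a := ⟨x⁻¹, hx⟩) (by simpa [Subtype.ext_iff] using h0)
    have : (x⁻¹ : L) * y = 1 := congrArg Subtype.val hy
    have : x = y := by field_simp at this; exact this.symm
    exact this ▸ y.2

instance [Finite k] [IsFunctionField k L] : IsDiscreteValuationRing P.ring :=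
  ((IsDiscreteValuationRing.TFAE P.ring P.not_isField).out 0 1).2
    (inferInstance : ValuationRing P.ring)

instance [Finite k] [IsFunctionField k L] : Finite P.residueField := by
  obtain ⟨x, hx⟩ := IsDiscreteValuationRing.exists_irreducible P.ring
  have := P.finite_quotient hx.ne_zero
  rw [← hx.maximalIdeal_eq] at this
  exact this

end Place
end Places

/-! ### The order function of a place. -/

section Ord
variable {k L : Type*} [Field k] [Field L] [Algebra k L]

namespace Place

variable (P : Place k L)

theorem mem_ring_of_mem_nonunits {x : L} (hx : x ∈ P.ring.nonunits) : x ∈ P.ring :=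
  P.ring.nonunits_subset hx

theorem valuation_coe_unit (u : (P.ring)ˣ) : P.ring.valuation ((u : P.ring) : L) = 1 :=
  (P.ring.valuation_eq_one_iff _).1 u.isUnit

theorem exists_unit_of_valuation_eq_one {x : L} (hx : P.ring.valuation x = 1) :
    ∃ u : (P.ring)ˣ, ((u : P.ring) : L) = x := by
  have hm : x ∈ P.ring := P.ring.mem_of_valuation_le_one x hx.le
  exact ⟨((P.ring.valuation_eq_one_iff ⟨x, hm⟩).2 hx).unit, rfl⟩

theorem irreducible_ne_zero {t : P.ring} (ht : Irreducible t) : (t : L) ≠ 0 := by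
  simpa using ht.ne_zero

theorem valuation_irreducible_lt_one {t : P.ring} (ht : Irreducible t) :
    P.ring.valuation (t : L) < 1 :=
  (P.ring.valuation_lt_one_iff t).1 ((mem_maximalIdeal t).2 ht.not_isUnit)

theorem isOrd_iff {f : L} {i : ℤ} : P.IsOrd f i ↔
    ∃ t : P.ring, Irreducible t ∧ P.ring.valuation f = P.ring.valuation (t : L) ^ i := by
  constructor
  · rintro ⟨t, ht, u, rfl⟩
    exact ⟨t, ht, by rw [map_mul, map_zpow₀, valuation_coe_unit, mul_one]⟩
  · rintro ⟨t, ht, h⟩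
    have h0 := P.irreducible_ne_zero ht
    have hv : P.ring.valuation (f / (t : L) ^ i) = 1 := by
      rw [map_div₀, map_zpow₀, h]
      exact div_self (zpow_ne_zero _ ((Valuation.ne_zero_iff _).2 h0))
    obtain ⟨u, hu⟩ := P.exists_unit_of_valuation_eq_one hv
    exact ⟨t, ht, u, by rw [hu]; field_simp⟩

theorem valuation_zpow_injective {t : P.ring} (ht : Irreducible t) :
    Function.Injective fun i : ℤ => P.ring.valuation (t : L) ^ i :=
  zpow_right_injective₀ (zero_lt_iff.2 ((Valuation.ne_zero_iff _).2 (P.irreducible_ne_zero ht)))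
    (P.valuation_irreducible_lt_one ht).ne

variable [Finite k] [IsFunctionField k L]

theorem valuation_irreducible_eq {t t' : P.ring} (ht : Irreducible t) (ht' : Irreducible t') :
    P.ring.valuation (t : L) = P.ring.valuation (t' : L) := by
  obtain ⟨u, rfl⟩ := IsDiscreteValuationRing.associated_of_irreducible P.ring ht ht'
  simp

theorem exists_isOrd {f : L} (hf : f ≠ 0) : ∃ i : ℤ, P.IsOrd f i := by
  obtain ⟨t, ht⟩ := IsDiscreteValuationRing.exists_irreducible P.ring
  have key : ∀ x : P.ring, x ≠ 0 → ∃ n : ℕ,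
      P.ring.valuation (x : L) = P.ring.valuation (t : L) ^ n := by
    intro x hx
    obtain ⟨n, u, rfl⟩ := IsDiscreteValuationRing.eq_unit_mul_pow_irreducible hx ht
    exact ⟨n, by simp⟩
  rcases P.ring.mem_or_inv_mem f with h | h
  · obtain ⟨n, hn⟩ := key ⟨f, h⟩ (by simpa [Subtype.ext_iff] using hf)
    exact ⟨n, P.isOrd_iff.2 ⟨t, ht, by simpa using hn⟩⟩
  · obtain ⟨n, hn⟩ := key ⟨f⁻¹, h⟩ (by simpa [Subtype.ext_iff] using hf)
    refine ⟨-n, P.isOrd_iff.2 ⟨t, ht, ?_⟩⟩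
    simp only [map_inv₀] at hn
    rw [zpow_neg, zpow_natCast, ← hn, inv_inv]

/-- The order at `P` is characterized by the valuation of a uniformizer. -/
theorem valuation_eq_zpow_ord {t : P.ring} (ht : Irreducible t) {f : L} (hf : f ≠ 0) :
    P.ring.valuation f = P.ring.valuation (t : L) ^ P.ord f := by
  have h := Classical.epsilon_spec (P.exists_isOrd hf)
  obtain ⟨t', ht', h⟩ := P.isOrd_iff.1 h
  rw [ord, if_neg hf, h, P.valuation_irreducible_eq ht ht']

theorem ord_eq_of_valuation_eq {t : P.ring} (ht : Irreducible t) {f : L} {i : ℤ}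
    (h : P.ring.valuation f = P.ring.valuation (t : L) ^ i) : P.ord f = i := by
  have hf : f ≠ 0 := by
    rintro rfl
    rw [map_zero] at h
    exact zpow_ne_zero i ((Valuation.ne_zero_iff _).2 (P.irreducible_ne_zero ht)) h.symm
  exact P.valuation_zpow_injective ht ((P.valuation_eq_zpow_ord ht hf).symm.trans h)

theorem ord_irreducible {t : P.ring} (ht : Irreducible t) : P.ord (t : L) = 1 :=
  P.ord_eq_of_valuation_eq ht (zpow_one _).symm

theorem ord_mul {f g : L} (hf : f ≠ 0) (hg : g ≠ 0) : P.ord (f * g) = P.ord f + P.ord g := by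
  obtain ⟨t, ht⟩ := IsDiscreteValuationRing.exists_irreducible P.ring
  refine P.ord_eq_of_valuation_eq ht ?_
  rw [map_mul, P.valuation_eq_zpow_ord ht hf, P.valuation_eq_zpow_ord ht hg,
    zpow_add₀ ((Valuation.ne_zero_iff _).2 (P.irreducible_ne_zero ht))]

theorem ord_pow {f : L} (hf : f ≠ 0) (n : ℕ) : P.ord (f ^ n) = n * P.ord f := by
  obtain ⟨t, ht⟩ := IsDiscreteValuationRing.exists_irreducible P.ring
  refine P.ord_eq_of_valuation_eq ht ?_
  rw [map_pow, P.valuation_eq_zpow_ord ht hf, mul_comm, zpow_mul, zpow_natCast]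

theorem ord_inv {f : L} (hf : f ≠ 0) : P.ord f⁻¹ = -P.ord f := by
  obtain ⟨t, ht⟩ := IsDiscreteValuationRing.exists_irreducible P.ring
  refine P.ord_eq_of_valuation_eq ht ?_
  rw [map_inv₀, P.valuation_eq_zpow_ord ht hf, zpow_neg]

theorem ord_eq_zero_iff {f : L} (hf : f ≠ 0) : P.ord f = 0 ↔ P.ring.valuation f = 1 := by
  obtain ⟨t, ht⟩ := IsDiscreteValuationRing.exists_irreducible P.ring
  refine ⟨fun h => by rw [P.valuation_eq_zpow_ord ht hf, h, zpow_zero], fun h => ?_⟩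
  exact P.ord_eq_of_valuation_eq ht (by rw [h, zpow_zero])

/-- A valuation ring of dimension at most one is maximal among the proper valuation rings. -/
theorem eq_of_ring_le {P P' : Place k L} (h : P.ring ≤ P'.ring) : P = P' := by
  have : Ring.KrullDimLE 1 P.ring := inferInstance
  exact Subtype.ext (ValuationSubring.eq_of_le_of_ne_top P.ring h P'.2.1)

theorem eventually_mul_pow_mem (b : L) {z : L} (hz : z ∈ P.ring.nonunits) :
    ∀ᶠ N : ℕ in Filter.atTop, b * z ^ N ∈ P.ring := by
  by_cases hb : b = 0
  · exact .of_forall fun N => by simp [hb, P.ring.zero_mem]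
  obtain ⟨t, ht⟩ := IsDiscreteValuationRing.exists_irreducible P.ring
  have htm : IsLocalRing.maximalIdeal P.ring = Ideal.span {t} := ht.maximalIdeal_eq
  obtain ⟨hz', hzm⟩ := P.ring.mem_nonunits_iff_exists_mem_maximalIdeal.1 hz
  obtain ⟨w, hw⟩ := Ideal.mem_span_singleton'.1 (htm.le hzm)
  filter_upwards [Filter.eventually_ge_atTop (-P.ord b).toNat] with N hN
  have h1 : b * (t : L) ^ N ∈ P.ring := by
    refine P.ring.mem_of_valuation_le_one _ ?_
    rw [map_mul, map_pow, P.valuation_eq_zpow_ord ht hb, ← zpow_natCast,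
      ← zpow_add₀ ((Valuation.ne_zero_iff _).2 (P.irreducible_ne_zero ht))]
    obtain ⟨m, hm⟩ := Int.eq_ofNat_of_zero_le (a := P.ord b + N) (by omega)
    rw [hm, zpow_natCast]
    exact pow_le_one' (P.valuation_irreducible_lt_one ht).le m
  have hz2 : z = (w : L) * t := (congrArg Subtype.val hw).symm
  have h2 : b * z ^ N = b * (t : L) ^ N * ((w ^ N : P.ring) : L) := by
    rw [hz2]
    push_cast
    ring
  rw [h2]
  exact P.ring.mul_mem _ _ h1 (w ^ N).2

end Place

end Ord

/-! ### Residues and evaluation at divisors. -/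

section Residue

variable {k L : Type*} [Field k] [Field L] [Algebra k L]

namespace Place

variable (P : Place k L)

theorem residue_of_mem {f : L} (hf : f ∈ P.ring) :
    P.residue f = IsLocalRing.residue P.ring ⟨f, hf⟩ := dif_pos hf

theorem residue_eq_iff {f g : L} (hf : f ∈ P.ring) (hg : g ∈ P.ring) :
    P.residue f = P.residue g ↔ f - g ∈ P.ring.nonunits := by
  rw [P.residue_of_mem hf, P.residue_of_mem hg, ← sub_eq_zero, ← map_sub,
    IsLocalRing.residue_eq_zero_iff, ← P.ring.coe_mem_nonunits_iff]
  rfl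

theorem residue_mul {f g : L} (hf : f ∈ P.ring) (hg : g ∈ P.ring) :
    P.residue (f * g) = P.residue f * P.residue g := by
  rw [P.residue_of_mem hf, P.residue_of_mem hg, P.residue_of_mem (P.ring.mul_mem _ _ hf hg),
    ← map_mul]
  rfl

theorem residue_pow {f : L} (hf : f ∈ P.ring) (n : ℕ) :
    P.residue (f ^ n) = P.residue f ^ n := by
  rw [P.residue_of_mem hf, P.residue_of_mem (pow_mem hf n), ← map_pow]
  rfl

theorem residue_one : P.residue 1 = 1 := by
  rw [P.residue_of_mem P.ring.one_mem]
  exact map_one _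

theorem residue_prod {ι : Type*} (s : Finset ι) (f : ι → L) (hf : ∀ i ∈ s, f i ∈ P.ring) :
    P.residue (∏ i ∈ s, f i) = ∏ i ∈ s, P.residue (f i) := by
  induction s using Finset.cons_induction with
  | empty => simp [residue_one]
  | cons a s ha ih =>
    rw [Finset.prod_cons, Finset.prod_cons, residue_mul, ih]
    · exact fun i hi => hf i (Finset.mem_cons_of_mem hi)
    · exact hf a (Finset.mem_cons_self a s)
    · exact prod_mem fun i hi => hf i (Finset.mem_cons_of_mem hi)

theorem exists_residue_eq (a : P.residueField) : ∃ x ∈ P.ring, P.residue x = a := by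
  obtain ⟨x, rfl⟩ := IsLocalRing.residue_surjective a
  exact ⟨x, x.2, P.residue_of_mem x.2⟩

theorem residue_const (c : algebraicClosure k L) :
    P.residue (c : L) = algebraMap (algebraicClosure k L) P.residueField c :=
  P.residue_of_mem (P.const_mem c)

/-- Congruences between constants modulo a single place are equalities; the final comparison in the
local computation rests on this. -/
theorem residue_const_injective {c d : L} (hc : c ∈ algebraicClosure k L)
    (hd : d ∈ algebraicClosure k L) (h : P.residue c = P.residue d) : c = d := by
  have := (P.residue_const ⟨c, hc⟩).symm.trans (h.trans (P.residue_const ⟨d, hd⟩))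
  simpa using (algebraMap (algebraicClosure k L) P.residueField).injective this

end Place

theorem evalAt_eq_prod (f : L) (D : Divisor k L) {T : Finset (Place k L)} (hT : D.support ⊆ T) :
    evalAt f D = ∏ P ∈ T, Algebra.norm (algebraicClosure k L) (P.residue f) ^ D P :=
  Finsupp.prod_of_support_subset _ hT _ fun _ _ => zpow_zero _

end Residue

/-! ### Weak approximation. -/

section Approximation
variable {k L : Type*} [Field k] [Field L] [Algebra k L]

namespace Place

theorem inv_one_add_pow_mem (P : Place k L) {z : L} (hz : z ∈ P.ring.nonunits) {N : ℕ}
    (hN : N ≠ 0) : (1 + z ^ N)⁻¹ ∈ P.ring := by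
  have h : P.ring.valuation (z ^ N) < 1 := by
    rw [map_pow]
    exact pow_lt_one₀ zero_le (P.ring.mem_nonunits_iff.1 hz) hN
  refine P.ring.mem_of_valuation_le_one _ ?_
  rw [map_inv₀, Valuation.map_one_add_of_lt _ h, inv_one]

variable [Finite k] [IsFunctionField k L]

theorem exists_mem_nonunits_forall_notMem (Q : Place k L) (T : Finset (Place k L)) (hQ : Q ∉ T) :
    ∃ z ∈ Q.ring.nonunits, ∀ P ∈ T, z ∉ P.ring := by
  induction T using Finset.cons_induction with
  | empty => exact ⟨0, zero_mem _, by simp⟩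
  | cons P T hP ih =>
    rw [Finset.mem_cons, not_or] at hQ
    obtain ⟨z, hzQ, hzT⟩ := ih hQ.2
    by_cases hzP : z ∈ P.ring
    swap
    · exact ⟨z, hzQ, fun P' hP' => by
        rcases Finset.mem_cons.1 hP' with rfl | h
        exacts [hzP, hzT _ h]⟩
    obtain ⟨a, haQ, haP⟩ := SetLike.not_le_iff_exists.1 (fun h => hQ.1 (eq_of_ring_le h))
    obtain ⟨b, hbP, hbQ⟩ := SetLike.not_le_iff_exists.1 (fun h => hQ.1 (eq_of_ring_le h).symm)
    have hb0 : b ≠ 0 := fun h => hbQ (h ▸ Q.ring.zero_mem)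
    have hwQ : a / b ∈ Q.ring.nonunits := by
      rw [ValuationSubring.mem_nonunits_iff, map_div₀]
      rw [← Q.ring.valuation_le_one_iff, not_le] at hbQ
      rw [← Q.ring.valuation_le_one_iff] at haQ
      exact (div_lt_one₀ (zero_lt_one.trans hbQ)).2 (haQ.trans_lt hbQ)
    have hwP : a / b ∉ P.ring := fun h => haP (by
      simpa [div_mul_cancel₀ a hb0] using P.ring.mul_mem _ _ h hbP)
    -- The quotient `a / b` vanishes at `Q` and has a pole at `P`. Where `a / b` is integral, `z`
    -- has a pole that survives the addition; where it has a pole, a large power of it dominates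
    -- `z`.
    have hev : ∀ P' ∈ Finset.cons P T hP, ∀ᶠ N : ℕ in Filter.atTop,
        z + (a / b) ^ N ∉ P'.ring := by
      intro P' hP'
      by_cases hw : a / b ∈ P'.ring
      · have hzP' : z ∉ P'.ring := by
          rcases Finset.mem_cons.1 hP' with rfl | h
          exacts [absurd hw hwP, hzT _ h]
        exact .of_forall fun N h => hzP' (by simpa using sub_mem h (pow_mem hw N))
      · have hw0 : a / b ≠ 0 := fun h => hw (h ▸ P'.ring.zero_mem)
        have hinv : (a / b)⁻¹ ∈ P'.ring.nonunits := P'.ring.inv_mem_nonunits_iff.2 (.inr hw)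
        have hw1 := not_le.1 (mt (P'.ring.valuation_le_one_iff _).1 hw)
        filter_upwards [P'.eventually_mul_pow_mem (z * (a / b)) hinv,
          Filter.eventually_ge_atTop 1] with N hN hN1 hmem
        have h1 : P'.ring.valuation z < P'.ring.valuation ((a / b) ^ N) := by
          rw [← P'.ring.valuation_le_one_iff, map_mul, map_mul, map_pow, map_inv₀, inv_pow,
            ← div_eq_mul_inv, div_le_one₀ (pow_pos (zero_lt_one.trans hw1) N)] at hN
          rw [map_pow]
          by_cases hz : P'.ring.valuation z = 0
          · rw [hz]
            exact pow_pos (zero_lt_one.trans hw1) N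
          · exact (lt_mul_of_one_lt_right (zero_lt_iff.2 hz) hw1).trans_le hN
        rw [← P'.ring.valuation_le_one_iff, Valuation.map_add_eq_of_lt_right _ h1, map_pow] at hmem
        exact absurd hmem (not_le.2 (one_lt_pow₀ hw1 (by omega)))
    obtain ⟨N, hN, hN1⟩ := (((Filter.eventually_all_finset _).2 hev).and
      (Filter.eventually_ge_atTop 1)).exists
    refine ⟨z + (a / b) ^ N, add_mem hzQ ?_, hN⟩
    rw [ValuationSubring.mem_nonunits_iff, map_pow]
    exact pow_lt_one₀ zero_le (Q.ring.mem_nonunits_iff.1 hwQ) (by omega)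

/-- Weak approximation at finitely many places. -/
theorem exists_forall_sub_div_mem (T : Finset (Place k L)) (a c : Place k L → L) :
    ∃ x : L, ∀ P ∈ T, (x - a P) / c P ∈ P.ring := by
  classical
  have hz : ∀ Q : Place k L, ∃ z ∈ Q.ring.nonunits, ∀ P ∈ T.erase Q, z ∉ P.ring := fun Q =>
    Q.exists_mem_nonunits_forall_notMem _ (Finset.notMem_erase Q T)
  choose z hzQ hzP using hz
  -- As N grows, `(1 + z Q ^ N)⁻¹` tends to 1 at `Q`, where `z Q` vanishes, and to 0 at the other
  -- places of `T`, where `z Q` has a pole. Summing `a Q` times these factors solves all conditions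
  -- at once.
  have hev : ∀ P ∈ T, ∀ Q ∈ T, ∀ᶠ N : ℕ in Filter.atTop,
      (a Q * (1 + z Q ^ N)⁻¹ - if P = Q then a Q else 0) / c P ∈ P.ring := by
    intro P hP Q hQ
    by_cases hPQ : P = Q
    · subst hPQ
      filter_upwards [P.eventually_mul_pow_mem (a P / c P) (hzQ P),
        Filter.eventually_ge_atTop 1] with N hN hN1
      have h1 := P.inv_one_add_pow_mem (hzQ P) (N := N) (by omega)
      have h0 : 1 + z P ^ N ≠ 0 := by
        intro h
        have h2 : P.ring.valuation (z P ^ N) < 1 := by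
          rw [map_pow]
          exact pow_lt_one₀ zero_le (P.ring.mem_nonunits_iff.1 (hzQ P)) (by omega)
        have h3 := Valuation.map_one_add_of_lt _ h2
        rw [h, map_zero] at h3
        exact zero_ne_one h3
      have h2 : (a P * (1 + z P ^ N)⁻¹ - if P = P then a P else 0) / c P =
          -(a P / c P * z P ^ N * (1 + z P ^ N)⁻¹) := by
        rw [if_pos rfl]
        field_simp
        ring
      rw [h2]
      exact neg_mem (mul_mem hN h1)
    · have hnm : z Q ∉ P.ring := hzP Q P (Finset.mem_erase.2 ⟨hPQ, hP⟩)
      have hu : (z Q)⁻¹ ∈ P.ring.nonunits := P.ring.inv_mem_nonunits_iff.2 (.inr hnm)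
      have hz0 : z Q ≠ 0 := fun h => hnm (h ▸ P.ring.zero_mem)
      filter_upwards [P.eventually_mul_pow_mem (a Q / c P) hu,
        Filter.eventually_ge_atTop 1] with N hN hN1
      have h1 := P.inv_one_add_pow_mem hu (N := N) (by omega)
      have h2 : (a Q * (1 + z Q ^ N)⁻¹ - if P = Q then a Q else 0) / c P =
          a Q / c P * (z Q)⁻¹ ^ N * (1 + (z Q)⁻¹ ^ N)⁻¹ := by
        have h3 : 1 + z Q ^ N = z Q ^ N * (1 + (z Q)⁻¹ ^ N) := by
          rw [inv_pow, mul_add, mul_one, mul_inv_cancel₀ (pow_ne_zero N hz0), add_comm]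
        rw [if_neg hPQ, h3, mul_inv, inv_pow, sub_zero]
        ring
      rw [h2]
      exact mul_mem hN h1
  obtain ⟨N, hN⟩ := ((Filter.eventually_all_finset _).2 fun P hP =>
    (Filter.eventually_all_finset _).2 (hev P hP)).exists
  refine ⟨∑ Q ∈ T, a Q * (1 + z Q ^ N)⁻¹, fun P hP => ?_⟩
  have h : (∑ Q ∈ T, a Q * (1 + z Q ^ N)⁻¹ - a P) / c P =
      ∑ Q ∈ T, (a Q * (1 + z Q ^ N)⁻¹ - if P = Q then a Q else 0) / c P := by
    rw [← Finset.sum_div, Finset.sum_sub_distrib, Finset.sum_ite_eq, if_pos hP]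
  rw [h]
  exact sum_mem fun Q hQ => hN P hP Q hQ

/-- Functions with prescribed orders at finitely many places. -/
theorem exists_forall_ord_eq (T : Finset (Place k L)) (i : Place k L → ℤ) :
    ∃ x : L, x ≠ 0 ∧ ∀ P ∈ T, P.ord x = i P := by
  -- For nonempty `T` the prescribed order forces x ≠ 0; for empty `T` nothing would.
  by_cases hT : T = ∅
  · exact ⟨1, one_ne_zero, by simp [hT]⟩
  choose t ht using fun P : Place k L => IsDiscreteValuationRing.exists_irreducible P.ring
  -- An error of order at least `i P + 1` cannot change the order `i P` of the target.
  obtain ⟨x, hx⟩ := exists_forall_sub_div_mem T (fun P => (t P : L) ^ i P)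
    (fun P => (t P : L) ^ (i P + 1))
  have hv : ∀ P ∈ T, P.ring.valuation x = P.ring.valuation (t P : L) ^ i P := by
    intro P hP
    have h0 := P.irreducible_ne_zero (ht P)
    have h1 := (P.ring.valuation_le_one_iff _).2 (hx P hP)
    have hv0 : 0 < P.ring.valuation (t P : L) := zero_lt_iff.2 ((Valuation.ne_zero_iff _).2 h0)
    have h2 : P.ring.valuation (x - (t P : L) ^ i P) < P.ring.valuation ((t P : L) ^ i P) := by
      rw [map_div₀, div_le_one₀ (by rw [map_zpow₀]; exact zpow_pos hv0 _)] at h1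
      refine h1.trans_lt ?_
      rw [zpow_add_one₀ h0, map_mul]
      exact mul_lt_of_lt_one_right (by rw [map_zpow₀]; exact zpow_pos hv0 _)
        (P.valuation_irreducible_lt_one (ht P))
    have h3 := Valuation.map_add_eq_of_lt_left _ h2
    rwa [add_sub_cancel, map_zpow₀] at h3
  refine ⟨x, ?_, fun P hP => P.ord_eq_of_valuation_eq (ht P) (hv P hP)⟩
  rintro rfl
  obtain ⟨P, hP⟩ := Finset.nonempty_iff_ne_empty.2 hT
  have h := hv P hP
  rw [map_zero] at h
  exact zpow_ne_zero _ ((Valuation.ne_zero_iff _).2 (P.irreducible_ne_zero (ht P))) h.symm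

end Place

end Approximation

/-! ### Places above and below in an extension. -/

section Extension

variable {k L L' : Type*} [Field k] [Field L] [Field L'] [Algebra k L] [Algebra k L'] [Algebra L L']

namespace Place

theorem IsAbove.mem_ring_iff {Q : Place k L'} {P : Place k L} (h : Q.IsAbove P) {x : L} :
    algebraMap L L' x ∈ Q.ring ↔ x ∈ P.ring := by
  rw [← h, ValuationSubring.mem_comap]

theorem IsAbove.mem_nonunits_iff {Q : Place k L'} {P : Place k L} (h : Q.IsAbove P) {x : L} :
    algebraMap L L' x ∈ Q.ring.nonunits ↔ x ∈ P.ring.nonunits := by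
  rw [ValuationSubring.mem_nonunits_iff_or, ValuationSubring.mem_nonunits_iff_or, ← map_inv₀,
    h.mem_ring_iff, map_eq_zero]

theorem valuation_eq_one_iff_mem (P : Place k L) {x : L} : P.ring.valuation x = 1 ↔
    x ∈ P.ring ∧ x ∉ P.ring.nonunits := by
  rw [← ValuationSubring.valuation_le_one_iff, ValuationSubring.mem_nonunits_iff, not_lt]
  exact le_antisymm_iff

theorem IsAbove.valuation_eq_one_iff {Q : Place k L'} {P : Place k L} (h : Q.IsAbove P) {x : L} :
    Q.ring.valuation (algebraMap L L' x) = 1 ↔ P.ring.valuation x = 1 := by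
  rw [valuation_eq_one_iff_mem, valuation_eq_one_iff_mem, h.mem_ring_iff, h.mem_nonunits_iff]

theorem IsAbove.unique {Q : Place k L'} {P P' : Place k L} (h : Q.IsAbove P)
    (h' : Q.IsAbove P') : P = P' := Subtype.ext (h.symm.trans h')

theorem IsAbove.trans {M : Type*} [Field M] [Algebra k M] [Algebra L M] [Algebra L' M]
    [IsScalarTower L L' M] {R : Place k M} {Q : Place k L'} {P : Place k L} (h : R.IsAbove Q)
    (h' : Q.IsAbove P) : R.IsAbove P := by
  refine ValuationSubring.ext _ _ fun x => ?_
  rw [ValuationSubring.mem_comap, IsScalarTower.algebraMap_apply L L' M, h.mem_ring_iff,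
    h'.mem_ring_iff]

theorem IsAbove.of_trans {M : Type*} [Field M] [Algebra k M] [Algebra L M] [Algebra L' M]
    [IsScalarTower L L' M] {R : Place k M} {Q : Place k L'} {P : Place k L} (h : R.IsAbove Q)
    (h' : R.IsAbove P) : Q.IsAbove P := by
  refine ValuationSubring.ext _ _ fun x => ?_
  rw [ValuationSubring.mem_comap, ← h.mem_ring_iff, ← IsScalarTower.algebraMap_apply L L' M,
    h'.mem_ring_iff]

variable [IsScalarTower k L L']

/-- The local ring of `P` maps by a local homomorphism into some valuation ring of `L'`. Locality
prevents the inverse of an element of the maximal ideal from becoming integral, so the trace on `L`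
is no larger. -/
theorem exists_isAbove (P : Place k L) : ∃ Q : Place k L', Q.IsAbove P := by
  obtain ⟨A, hA, hloc⟩ := IsLocalRing.exists_factor_valuationRing
    ((algebraMap L L').comp P.ring.subtype)
  have hA' : ∀ x ∈ P.ring, algebraMap L L' x ∈ A := fun x hx => hA ⟨x, hx⟩
  have hcomap : A.comap (algebraMap L L') = P.ring := by
    refine ValuationSubring.ext _ _ fun x => ⟨fun hx => ?_, fun hx => hA' x hx⟩
    by_contra hxP
    have hinv : x⁻¹ ∈ P.ring.nonunits := P.ring.inv_mem_nonunits_iff.2 (.inr hxP)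
    have hx0 : x ≠ 0 := fun h => hxP (h ▸ P.ring.zero_mem)
    have hm := P.mem_ring_of_mem_nonunits hinv
    have hu : IsUnit ((((algebraMap L L').comp P.ring.subtype).codRestrict A.toSubring hA)
        ⟨x⁻¹, hm⟩) := by
      refine IsUnit.of_mul_eq_one (⟨algebraMap L L' x, hx⟩ : A.toSubring) (Subtype.ext ?_)
      change algebraMap L L' x⁻¹ * algebraMap L L' x = 1
      rw [← map_mul, inv_mul_cancel₀ hx0, map_one]
    have := hloc.map_nonunit _ hu
    exact (mem_maximalIdeal _).1 (P.ring.coe_mem_nonunits_iff.1 hinv) this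
  refine ⟨⟨A, fun h => P.2.1 ?_, fun c => ?_⟩, hcomap⟩
  · change P.ring = ⊤
    rw [← hcomap, h]
    rfl
  · rw [IsScalarTower.algebraMap_apply k L L']
    exact hA' _ (P.2.2 c)

/-- If the trace were all of L, then `L'`, being integral over L, would lie in the integrally closed
ring of `Q`. -/
theorem exists_place_below [Algebra.IsAlgebraic L L'] (Q : Place k L') :
    ∃ P : Place k L, Q.IsAbove P := by
  refine ⟨⟨Q.ring.comap (algebraMap L L'), fun h => Q.2.1 ?_, fun c => ?_⟩, rfl⟩
  · have hmem : ∀ x : L, algebraMap L L' x ∈ Q.ring := fun x => by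
      rw [← ValuationSubring.mem_comap, h]
      exact ValuationSubring.mem_top x
    refine top_unique fun y _ => ?_
    obtain ⟨p, hp, hy⟩ := (Algebra.IsAlgebraic.isAlgebraic (R := L) y).isIntegral
    have h2 : IsIntegral Q.ring y := by
      refine ⟨p.map ((algebraMap L L').codRestrict Q.ring hmem), hp.map _, ?_⟩
      rw [Polynomial.eval₂_map]
      exact hy
    obtain ⟨z, rfl⟩ := IsIntegrallyClosed.isIntegral_iff.1 h2
    exact z.2
  · rw [ValuationSubring.mem_comap, ← IsScalarTower.algebraMap_apply k L L']
    exact Q.2.2 c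

end Place

end Extension

/-! ### The Galois group acts transitively on the places above a given one. -/

section GaloisAction

variable {k L L' : Type*} [Field k] [Field L] [Field L'] [Algebra k L] [Algebra k L'] [Algebra L L']
  [IsScalarTower k L L']

namespace Place

/-- The action of the Galois group on the places. -/
instance : MulAction (L' ≃ₐ[L] L') (Place k L') where
  smul σ Q := ⟨Q.ring.comap (σ.symm : L' →+* L'), fun h => Q.2.1 (top_unique fun x _ => by
      have hx : σ x ∈ Q.ring.comap (σ.symm : L' →+* L') := by
        rw [h]
        exact ValuationSubring.mem_top _
      have hx' : σ.symm (σ x) ∈ Q.ring := hx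
      rwa [σ.symm_apply_apply] at hx'), fun c => by
    rw [ValuationSubring.mem_comap, IsScalarTower.algebraMap_apply k L L']
    change σ.symm (algebraMap L L' _) ∈ Q.ring
    rw [AlgEquiv.commutes, ← IsScalarTower.algebraMap_apply k L L']
    exact Q.2.2 c⟩
  one_smul Q := Subtype.ext (ValuationSubring.ext _ _ fun _ => Iff.rfl)
  mul_smul σ τ Q := Subtype.ext (ValuationSubring.ext _ _ fun _ => Iff.rfl)

variable (σ : L' ≃ₐ[L] L') (Q : Place k L')

theorem mem_smul_ring_iff {x : L'} : x ∈ (σ • Q).ring ↔ σ⁻¹ x ∈ Q.ring := Iff.rfl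

theorem mem_smul_nonunits_iff {x : L'} : x ∈ (σ • Q).ring.nonunits ↔ σ⁻¹ x ∈ Q.ring.nonunits := by
  rw [ValuationSubring.mem_nonunits_iff_or, ValuationSubring.mem_nonunits_iff_or,
    mem_smul_ring_iff, map_inv₀, map_eq_zero_iff _ σ⁻¹.injective]

theorem valuation_smul_eq_one_iff {x : L'} :
    (σ • Q).ring.valuation x = 1 ↔ Q.ring.valuation (σ⁻¹ x) = 1 := by
  rw [valuation_eq_one_iff_mem, valuation_eq_one_iff_mem, mem_smul_ring_iff, mem_smul_nonunits_iff]

variable {σ Q}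

theorem IsAbove.smul {P : Place k L} (h : Q.IsAbove P) (σ : L' ≃ₐ[L] L') : (σ • Q).IsAbove P := by
  refine ValuationSubring.ext _ _ fun x => ?_
  rw [ValuationSubring.mem_comap, mem_smul_ring_iff, AlgEquiv.commutes, h.mem_ring_iff]

variable [Finite k] [IsFunctionField k L']

theorem mem_nonunits_of_ord_pos (Q : Place k L') {x : L'} (h : 0 < Q.ord x) :
    x ∈ Q.ring.nonunits := by
  obtain ⟨t, ht⟩ := IsDiscreteValuationRing.exists_irreducible Q.ring
  have hx : x ≠ 0 := by
    rintro rfl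
    simp [ord] at h
  obtain ⟨n, hn⟩ := Int.eq_ofNat_of_zero_le h.le
  rw [ValuationSubring.mem_nonunits_iff, Q.valuation_eq_zpow_ord ht hx, hn, zpow_natCast]
  exact pow_lt_one₀ zero_le (Q.valuation_irreducible_lt_one ht) (by omega)

/-- Elements congruent to prescribed ones modulo finitely many places. -/
theorem exists_forall_sub_mem_nonunits (T : Finset (Place k L')) (a : Place k L' → L') :
    ∃ x : L', ∀ P ∈ T, x - a P ∈ P.ring.nonunits := by
  choose t ht using fun P : Place k L' => IsDiscreteValuationRing.exists_irreducible P.ring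
  obtain ⟨x, hx⟩ := exists_forall_sub_div_mem T a fun P => (t P : L')
  refine ⟨x, fun P hP => ?_⟩
  have h0 := P.irreducible_ne_zero (ht P)
  have h := (P.ring.valuation_le_one_iff _).2 (hx P hP)
  rw [map_div₀, div_le_one₀ (zero_lt_iff.2 ((Valuation.ne_zero_iff _).2 h0))] at h
  exact P.ring.mem_nonunits_iff.2 (h.trans_lt (P.valuation_irreducible_lt_one (ht P)))

variable [FiniteDimensional L L'] [IsGalois L L']

/-- If the orbits of Q and Q' were disjoint, an x of order 1 along the first and 0 along the second
would have a norm lying in the maximal ideal at Q but a unit at Q'. That norm comes from L, where Q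
and Q' induce the same place. -/
theorem IsAbove.exists_smul_eq {P : Place k L} {Q Q' : Place k L'} (h : Q.IsAbove P)
    (h' : Q'.IsAbove P) : ∃ σ : L' ≃ₐ[L] L', σ • Q = Q' := by
  classical
  by_contra! hne
  let T : Finset (Place k L') := Finset.univ.image fun σ : L' ≃ₐ[L] L' => σ • Q
  let T' : Finset (Place k L') := Finset.univ.image fun σ : L' ≃ₐ[L] L' => σ • Q'
  obtain ⟨x, hx0, hx⟩ := exists_forall_ord_eq (T ∪ T') fun R => if R ∈ T then 1 else 0
  have h1 : ∀ σ : L' ≃ₐ[L] L', σ x ∈ Q.ring.nonunits := by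
    intro σ
    have hT : σ⁻¹ • Q ∈ T := Finset.mem_image_of_mem _ (Finset.mem_univ _)
    have := hx (σ⁻¹ • Q) (Finset.mem_union_left _ hT)
    rw [if_pos hT] at this
    simpa [mem_smul_nonunits_iff] using mem_nonunits_of_ord_pos (σ⁻¹ • Q) (by omega)
  have h2 : ∀ σ : L' ≃ₐ[L] L', Q'.ring.valuation (σ x) = 1 := by
    intro σ
    have hT' : σ⁻¹ • Q' ∈ T' := Finset.mem_image_of_mem _ (Finset.mem_univ _)
    have hT : σ⁻¹ • Q' ∉ T := fun hm => by
      obtain ⟨τ, -, hτ⟩ := Finset.mem_image.1 hm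
      exact hne (σ * τ) (by rw [mul_smul, hτ, smul_inv_smul])
    have := hx (σ⁻¹ • Q') (Finset.mem_union_right _ hT')
    rw [if_neg hT, ord_eq_zero_iff _ hx0, valuation_smul_eq_one_iff, inv_inv] at this
    exact this
  have h3 : algebraMap L L' (Algebra.norm L x) ∈ Q.ring.nonunits := by
    rw [Algebra.norm_eq_prod_automorphisms, ValuationSubring.mem_nonunits_iff, map_prod,
      ← Finset.mul_prod_erase _ _ (Finset.mem_univ 1)]
    refine mul_lt_one_of_lt_of_le (Q.ring.mem_nonunits_iff.1 (h1 1)) ?_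
    exact Finset.prod_le_one' fun σ _ => (Q.ring.mem_nonunits_iff.1 (h1 σ)).le
  have h4 : Q'.ring.valuation (algebraMap L L' (Algebra.norm L x)) = 1 := by
    rw [Algebra.norm_eq_prod_automorphisms, map_prod]
    exact Finset.prod_eq_one fun σ _ => h2 σ
  rw [h'.valuation_eq_one_iff, valuation_eq_one_iff_mem] at h4
  exact h4.2 (h.mem_nonunits_iff.1 h3)

variable (L') in
theorem finite_setOf_isAbove (P : Place k L) : {Q : Place k L' | Q.IsAbove P}.Finite := by
  obtain ⟨Q, hQ⟩ := P.exists_isAbove (L' := L')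
  refine (Set.finite_range fun σ : L' ≃ₐ[L] L' => σ • Q).subset fun Q' hQ' => ?_
  exact hQ.exists_smul_eq hQ'

end Place

end GaloisAction

/-! ### Ramification indices and the conorm. -/

section Ramification

variable {k L L' : Type*} [Field k] [Field L] [Field L'] [Algebra k L] [Algebra k L'] [Algebra L L']

theorem Place.ord_zpow [Finite k] [IsFunctionField k L] (P : Place k L) {f : L} (hf : f ≠ 0)
    (i : ℤ) : P.ord (f ^ i) = i * P.ord f := by
  obtain ⟨t, ht⟩ := IsDiscreteValuationRing.exists_irreducible P.ring
  refine P.ord_eq_of_valuation_eq ht ?_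
  rw [map_zpow₀, P.valuation_eq_zpow_ord ht hf, mul_comm, zpow_mul]

theorem Place.ord_nonneg [Finite k] [IsFunctionField k L] (P : Place k L) {f : L} (hf : f ∈ P.ring) :
    0 ≤ P.ord f := by
  by_contra! h
  have h0 : f ≠ 0 := by
    rintro rfl
    simp [ord] at h
  have h1 := P.mem_nonunits_of_ord_pos (x := f⁻¹) (by rw [P.ord_inv h0]; omega)
  rcases P.ring.inv_mem_nonunits_iff.1 h1 with h | h
  exacts [h0 h, h hf]

variable [Finite k] [IsFunctionField k L] [IsFunctionField k L']

theorem ord_algebraMap {Q : Place k L'} {P : Place k L} (h : Q.IsAbove P) {x : L} (hx : x ≠ 0) :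
    Q.ord (algebraMap L L' x) = ramIndex Q P * P.ord x := by
  obtain ⟨t, ht⟩ := IsDiscreteValuationRing.exists_irreducible P.ring
  have ht0 := P.irreducible_ne_zero ht
  have hex : ∃ e : ℕ, ∀ x : L, x ≠ 0 → Q.ord (algebraMap L L' x) = e * P.ord x := by
    -- The index is the order at `Q` of a uniformizer of `P`; units of `P` remain units at `Q`.
    refine ⟨(Q.ord (algebraMap L L' t)).toNat, fun x hx => ?_⟩
    rw [Int.toNat_of_nonneg (Q.ord_nonneg (h.mem_ring_iff.2 t.2))]
    have hv : P.ring.valuation (x / (t : L) ^ P.ord x) = 1 := by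
      rw [map_div₀, map_zpow₀, ← P.valuation_eq_zpow_ord ht hx]
      exact div_self ((Valuation.ne_zero_iff _).2 hx)
    have h0 : x / (t : L) ^ P.ord x ≠ 0 := div_ne_zero hx (zpow_ne_zero _ ht0)
    have h1 := (Q.ord_eq_zero_iff (f := algebraMap L L' (x / (t : L) ^ P.ord x))
      ((map_ne_zero _).2 h0)).2 (h.valuation_eq_one_iff.2 hv)
    have h2 : x = x / (t : L) ^ P.ord x * (t : L) ^ P.ord x :=
      (div_mul_cancel₀ _ (zpow_ne_zero _ ht0)).symm
    conv_lhs => rw [h2]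
    have ht1 : algebraMap L L' t ≠ 0 := by simpa using ht0
    rw [map_mul, Q.ord_mul ((map_ne_zero _).2 h0) ((map_ne_zero _).2 (zpow_ne_zero _ ht0)), h1,
      map_zpow₀, Q.ord_zpow ht1, zero_add, mul_comm]
  exact Classical.epsilon_spec hex x hx

variable {M : Type*} [Field M] [Algebra k M] [Algebra L M] [Algebra L' M]
    [IsScalarTower L L' M] [IsFunctionField k M]

theorem ramIndex_mul {R : Place k M} {Q : Place k L'} {P : Place k L} (h : R.IsAbove Q)
    (h' : Q.IsAbove P) : ramIndex R P = ramIndex R Q * ramIndex Q P := by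
  obtain ⟨t, ht⟩ := IsDiscreteValuationRing.exists_irreducible P.ring
  have ht0 := P.irreducible_ne_zero ht
  have h1 := ord_algebraMap (h.trans h') ht0
  rw [IsScalarTower.algebraMap_apply L L' M, ord_algebraMap h (by simpa using ht0),
    ord_algebraMap h' ht0, P.ord_irreducible ht] at h1
  zify
  linarith

end Ramification

section Conorm

variable {k L L' : Type*} [Field k] [Field L] [Field L'] [Algebra k L] [Algebra k L'] [Algebra L L']
  [IsScalarTower k L L'] [Finite k] [IsFunctionField k L'] [FiniteDimensional L L'] [IsGalois L L']

theorem conorm_apply (D : Divisor k L) {Q : Place k L'} {P : Place k L} (h : Q.IsAbove P) :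
    conorm L' D Q = D P * ramIndex Q P := by
  classical
  have hfin : ∀ P' : Place k L, (∑ᶠ Q' : {Q : Place k L' // Q.IsAbove P'},
      Finsupp.single Q'.1 (ramIndex Q'.1 P' : ℤ)) Q = if P' = P then (ramIndex Q P : ℤ) else 0 := by
    intro P'
    have : Finite {Q : Place k L' // Q.IsAbove P'} := Place.finite_setOf_isAbove L' P'
    have := Fintype.ofFinite {Q : Place k L' // Q.IsAbove P'}
    rw [finsum_eq_sum_of_fintype, Finsupp.finsetSum_apply]
    split_ifs with hP
    · subst hP
      rw [Finset.sum_eq_single ⟨Q, h⟩]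
      · simp
      · intro b _ hb
        exact Finsupp.single_eq_of_ne fun hQ => hb (Subtype.ext hQ.symm)
      · simp
    · refine Finset.sum_eq_zero fun b _ => Finsupp.single_eq_of_ne fun hQ => hP ?_
      exact b.2.unique (hQ ▸ h)
  rw [conorm, Finsupp.sum_apply, Finsupp.sum]
  simp only [Finsupp.smul_apply, hfin, smul_eq_mul, mul_ite, mul_zero]
  rw [Finset.sum_ite_eq']
  split_ifs with hP
  · rfl
  · simp [Finsupp.notMem_support_iff.1 hP]

end Conorm

/-! ### Existence of Frobenius automorphisms. -/

section Frobenius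

/-- The polynomial ∏ (X - σ a) has coefficients in K ∩ S, whose images ψ fixes. So ψ permits its
root π(a) to move only to another root, which is some π(σ a). This serves both for constants and for
residue fields. -/
theorem exists_map_eq_of_fixes {K L κ : Type*} [Field K] [Field L] [Algebra K L]
    [FiniteDimensional K L] [IsGalois K L] [CommRing κ] [IsDomain κ] (S : Subring L) (π : S →+* κ)
    (ψ : κ →+* κ) (hψ : ∀ (l : K) (h : algebraMap K L l ∈ S), ψ (π ⟨_, h⟩) = π ⟨_, h⟩) (a : L)
    (ha : ∀ σ : L ≃ₐ[K] L, σ a ∈ S) :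
    ∃ σ : L ≃ₐ[K] L, ψ (π ⟨a, ha 1⟩) = π ⟨σ a, ha σ⟩ := by
  let f : Polynomial S := ∏ σ : L ≃ₐ[K] L, (Polynomial.X - Polynomial.C ⟨σ a, ha σ⟩)
  have hf : f.map S.subtype = ∏ σ : L ≃ₐ[K] L, (Polynomial.X - Polynomial.C (σ a)) := by
    simp [f, Polynomial.map_prod]
  have hfix : ∀ τ : L ≃ₐ[K] L, (f.map S.subtype).map (τ : L →+* L) = f.map S.subtype := by
    intro τ
    rw [hf, Polynomial.map_prod]
    refine Fintype.prod_equiv (Equiv.mulLeft τ) _ _ fun σ => ?_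
    simp
  have hcoeff : ∀ i, ψ (π (f.coeff i)) = π (f.coeff i) := by
    intro i
    have h1 : ((f.coeff i : S) : L) ∈ Set.range (algebraMap K L) := by
      refine (IsGalois.mem_range_algebraMap_iff_fixed _).2 fun τ => ?_
      have := congrArg (fun p => Polynomial.coeff p i) (hfix τ)
      simpa using this
    obtain ⟨l, hl⟩ := h1
    have h2 : f.coeff i = ⟨algebraMap K L l, hl ▸ (f.coeff i).2⟩ := Subtype.ext hl.symm
    rw [h2]
    exact hψ l _
  have hmap : (f.map π).map ψ = f.map π := by
    ext i
    simp [hcoeff]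
  have h0 : (f.map π).eval (ψ (π ⟨a, ha 1⟩)) = 0 := by
    rw [← hmap, Polynomial.eval_map_apply, Polynomial.eval_map_apply]
    have : f.eval ⟨a, ha 1⟩ = 0 := by
      rw [Polynomial.eval_prod]
      exact Finset.prod_eq_zero (Finset.mem_univ 1) (by simp)
    rw [this, map_zero, map_zero]
  rw [Polynomial.map_prod, Polynomial.eval_prod, Finset.prod_eq_zero_iff] at h0
  obtain ⟨σ, -, hσ⟩ := h0
  exact ⟨σ, by simpa [sub_eq_zero] using hσ⟩

variable {k L L' : Type*} [Field k] [Field L] [Field L'] [Algebra k L] [Algebra k L'] [Algebra L L']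
  [IsScalarTower k L L']

theorem exists_frobenius_on_constants [Finite k] [FiniteDimensional L L'] [IsGalois L L']
    (hL : algebraicClosure k L = ⊥) :
    ∃ σ : L' ≃ₐ[L] L', ∀ c ∈ algebraicClosure k L', σ c = c ^ Nat.card k := by
  have := Fintype.ofFinite k
  by_contra! hne
  -- If every automorphism fails at some constant, these finitely many failures lie in one finite
  -- field `K`. An automorphism that is Frobenius on a generator of its unit group is Frobenius on
  -- all of `K`, a contradiction.
  choose c hc hcne using hne
  let K := IntermediateField.adjoin k (Set.range c)
  have hK : FiniteDimensional k K := IntermediateField.finiteDimensional_adjoin <| by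
    rintro _ ⟨σ, rfl⟩
    exact (mem_algebraicClosure_iff.1 (hc σ)).isIntegral
  have hKC : K ≤ algebraicClosure k L' := IntermediateField.adjoin_le_iff.2 <| by
    rintro _ ⟨σ, rfl⟩
    exact hc σ
  have : Finite K := Module.finite_of_finite k
  obtain ⟨ζ, hζ⟩ := IsCyclic.exists_generator (α := Kˣ)
  have hmem : ∀ σ : L' ≃ₐ[L] L', σ ((ζ : K) : L') ∈ (algebraicClosure k L').toSubring := by
    intro σ
    have := mem_algebraicClosure_iff.1 (hKC (ζ : K).2)
    exact mem_algebraicClosure_iff.2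
      ((isAlgebraic_algHom_iff (σ.restrictScalars k).toAlgHom σ.injective).2 this)
  obtain ⟨σ, hσ⟩ := exists_map_eq_of_fixes (K := L) (algebraicClosure k L').toSubring
    (Subring.subtype _) (FiniteField.frobeniusAlgHom k L').toRingHom (fun l h => by
      have h1 : l ∈ algebraicClosure k L := mem_algebraicClosure_iff.2
        ((isAlgebraic_algebraMap_iff (algebraMap L L').injective).1 (mem_algebraicClosure_iff.1 h))
      rw [hL] at h1
      obtain ⟨a, rfl⟩ := IntermediateField.mem_bot.1 h1
      simp only [Subring.subtype_apply, AlgHom.toRingHom_eq_coe, RingHom.coe_coe]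
      rw [← IsScalarTower.algebraMap_apply, AlgHom.commutes]) _ hmem
  have hσ' : σ ((ζ : K) : L') = ((ζ : K) : L') ^ Nat.card k := by
    rw [Nat.card_eq_fintype_card]
    exact hσ.symm
  have hall : ∀ x ∈ K, σ x = x ^ Nat.card k := by
    intro x hx
    by_cases hx0 : x = 0
    · rw [hx0, map_zero, zero_pow Nat.card_pos.ne']
    obtain ⟨i, hi⟩ := hζ (Units.mk0 (⟨x, hx⟩ : K) (by simpa [Subtype.ext_iff] using hx0))
    have hi' : x = ((ζ : K) : L') ^ i := by
      have := congrArg (fun u : Kˣ => K.val (u : K)) hi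
      rw [Units.val_zpow_eq_zpow_val, map_zpow₀] at this
      exact this.symm
    rw [hi', map_zpow₀, hσ', ← zpow_natCast, ← zpow_natCast, zpow_comm]
  exact hcne σ (hall _ (IntermediateField.subset_adjoin k _ ⟨σ, rfl⟩))

theorem Place.natCard_residueField [Finite k] [IsFunctionField k L] (P : Place k L) :
    Nat.card P.residueField = Nat.card k ^ P.deg :=
  Module.natCard_eq_pow_finrank

/-- Take a congruent to a generator of the residue units at one Q above P, and to 0 at its other
conjugates. A σ with σ(a) ≡ a^{N(P)} mod Q must then fix Q, and it is the N(P)-power map on the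
residue field because powers of a represent all nonzero classes. -/
theorem exists_isArtinSymbol [Finite k] [IsFunctionField k L] [IsFunctionField k L']
    [FiniteDimensional L L'] [IsAbelianGalois L L'] (P : Place k L) :
    ∃ σ : L' ≃ₐ[L] L', IsArtinSymbol P σ := by
  classical
  have := Fintype.ofFinite k
  obtain ⟨Q, hQ⟩ := P.exists_isAbove (L' := L')
  obtain ⟨ζ, hζ⟩ := IsCyclic.exists_generator (α := (Q.residueField)ˣ)
  obtain ⟨z, hz, hzζ⟩ := Q.exists_residue_eq (ζ : Q.residueField)
  obtain ⟨a, ha⟩ := Place.exists_forall_sub_mem_nonunits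
    (Finset.univ.image fun σ : L' ≃ₐ[L] L' => σ • Q) fun R => if R = Q then z else 0
  have haQ : a - z ∈ Q.ring.nonunits := by
    have := ha Q (Finset.mem_image.2 ⟨1, Finset.mem_univ _, one_smul _ Q⟩)
    rwa [if_pos rfl] at this
  have haR : ∀ σ : L' ≃ₐ[L] L', σ • Q ≠ Q → a ∈ (σ • Q).ring.nonunits := fun σ hσ => by
    have := ha (σ • Q) (Finset.mem_image.2 ⟨σ, Finset.mem_univ _, rfl⟩)
    rwa [if_neg hσ, sub_zero] at this
  have haQ' : a ∈ Q.ring := by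
    simpa using add_mem (Q.mem_ring_of_mem_nonunits haQ) hz
  have hares : Q.residue a = ζ := by
    rw [← hzζ]
    exact (Q.residue_eq_iff haQ' hz).2 haQ
  have hmem : ∀ σ : L' ≃ₐ[L] L', σ a ∈ Q.ring := by
    intro σ
    have h : a ∈ (σ⁻¹ • Q).ring := by
      by_cases hσ : σ⁻¹ • Q = Q
      · rwa [hσ]
      · exact (σ⁻¹ • Q).mem_ring_of_mem_nonunits (haR _ hσ)
    simpa [Place.mem_smul_ring_iff] using h
  have hψ : ∀ x : Q.residueField, ((FiniteField.frobeniusAlgHom k Q.residueField) ^ P.deg) x =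
      x ^ P.absNorm := by
    intro x
    rw [Place.absNorm, P.natCard_residueField, AlgHom.coe_pow, FiniteField.coe_frobeniusAlgHom,
      pow_iterate, Nat.card_eq_fintype_card]
  have hpow : ∀ l ∈ P.ring, l ^ P.absNorm - l ∈ P.ring.nonunits := by
    intro l hl
    refine (P.residue_eq_iff (pow_mem hl _) hl).1 ?_
    have := Fintype.ofFinite P.residueField
    rw [P.residue_pow hl, Place.absNorm, Nat.card_eq_fintype_card, FiniteField.pow_card]
  obtain ⟨σ, hσ⟩ := exists_map_eq_of_fixes (K := L) Q.ring.toSubring (IsLocalRing.residue Q.ring)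
    ((FiniteField.frobeniusAlgHom k Q.residueField) ^ P.deg : _ →ₐ[k] _).toRingHom
    (fun l h => by
      have hl : l ∈ P.ring := hQ.mem_ring_iff.1 h
      have h1 : Q.residue (algebraMap L L' l ^ P.absNorm) = Q.residue (algebraMap L L' l) := by
        rw [Q.residue_eq_iff (pow_mem h _) h, ← map_pow, ← map_sub, hQ.mem_nonunits_iff]
        exact hpow l hl
      rw [Q.residue_pow h, Q.residue_of_mem h] at h1
      exact (hψ _).trans h1) a hmem
  have hσ' : Q.residue (σ a) = Q.residue a ^ P.absNorm := by
    rw [Q.residue_of_mem (hmem σ), Q.residue_of_mem haQ']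
    exact hσ.symm.trans (hψ _)
  have hfix : σ⁻¹ • Q = Q := by
    by_contra hne
    have h1 := haR _ hne
    rw [Place.mem_smul_nonunits_iff, inv_inv] at h1
    have h2 : Q.residue (σ a) = Q.residue 0 :=
      (Q.residue_eq_iff (hmem σ) Q.ring.zero_mem).2 (by simpa using h1)
    rw [hσ', hares, Q.residue_of_mem Q.ring.zero_mem] at h2
    exact pow_ne_zero _ ζ.ne_zero (h2.trans (map_zero _))
  have hnon : ∀ x ∈ Q.ring.nonunits, σ x ∈ Q.ring.nonunits := by
    intro x hx
    rw [← hfix, Place.mem_smul_nonunits_iff, inv_inv] at hx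
    exact hx
  have hmemQ : ∀ x ∈ Q.ring, σ x ∈ Q.ring := by
    intro x hx
    rw [← hfix, Place.mem_smul_ring_iff, inv_inv] at hx
    exact hx
  have hN : P.absNorm ≠ 0 := Nat.card_pos.ne'
  have hmain : ∀ x ∈ Q.ring, σ x - x ^ P.absNorm ∈ Q.ring.nonunits := by
    intro x hx
    rw [← Q.residue_eq_iff (hmemQ x hx) (pow_mem hx _), Q.residue_pow hx]
    by_cases hx0 : Q.residue x = 0
    · have h1 : x ∈ Q.ring.nonunits := by
        rw [← sub_zero x, ← Q.residue_eq_iff hx Q.ring.zero_mem, hx0,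
          Q.residue_of_mem Q.ring.zero_mem]
        exact (map_zero _).symm
      rw [hx0, zero_pow hN]
      have h2 : Q.residue (σ x) = Q.residue 0 :=
        (Q.residue_eq_iff (hmemQ x hx) Q.ring.zero_mem).2 (by simpa using hnon x h1)
      rw [h2, Q.residue_of_mem Q.ring.zero_mem]
      exact map_zero _
    · obtain ⟨i, hi⟩ := (mem_powers_iff_mem_zpowers (x := ζ)).2 (hζ (Units.mk0 _ hx0))
      have hi' : Q.residue x = Q.residue (a ^ i) := by
        rw [Q.residue_pow haQ', hares]
        simpa using (congrArg Units.val hi).symm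
      have h1 := hnon _ ((Q.residue_eq_iff hx (pow_mem haQ' i)).1 hi')
      rw [map_sub, map_pow, ← Q.residue_eq_iff (hmemQ x hx) (pow_mem (hmem σ) i),
        Q.residue_pow (hmem σ), hσ'] at h1
      rw [h1, hi', Q.residue_pow haQ', ← pow_mul, ← pow_mul, mul_comm]
  refine ⟨σ, fun Q' hQ' x hx => ?_⟩
  obtain ⟨τ, rfl⟩ := hQ.exists_smul_eq hQ'
  rw [Place.mem_smul_ring_iff] at hx
  have h1 := hmain _ hx
  -- Commutativity of the Galois group carries the congruence from `Q` to all conjugate places.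
  have hcomm : σ (τ⁻¹ x) = τ⁻¹ (σ x) := by
    have : σ * τ⁻¹ = τ⁻¹ * σ := IsMulCommutative.is_comm.comm _ _
    exact DFunLike.congr_fun this x
  rw [hcomm, ← map_pow, ← map_sub] at h1
  rwa [Place.mem_smul_nonunits_iff]

theorem isArtinSymbol_artinSymbol [Finite k] [IsFunctionField k L] [IsFunctionField k L']
    [FiniteDimensional L L'] [IsAbelianGalois L L'] (P : Place k L) :
    IsArtinSymbol P (artinSymbol L' P) :=
  Classical.epsilon_spec (exists_isArtinSymbol P)

end Frobenius

/-- The map (j, l) ↦ j + r l mod d is a bijection onto the residues mod d: reduction mod gcd(d, r)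
recovers j, and cancelling r recovers l mod d / gcd(d, r). -/
theorem prod_range_gcd_prod_range {M : Type*} [CommMonoid M] (ψ : ℕ → M) {d : ℕ} (hd : 0 < d)
    (r : ℕ) (hψ : Function.Periodic ψ d) :
    ∏ j ∈ Finset.range (d.gcd r), ∏ l ∈ Finset.range (d / d.gcd r), ψ (j + r * l) =
      ∏ i ∈ Finset.range d, ψ i := by
  have hg : 0 < d.gcd r := Nat.gcd_pos_of_pos_left r hd
  let e : ℕ × ℕ → ℕ := fun p => (p.1 + r * p.2) % d
  let T := Finset.range (d.gcd r) ×ˢ Finset.range (d / d.gcd r)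
  have hinj : Set.InjOn e T := by
    rintro ⟨j, l⟩ h ⟨j', l'⟩ h' heq
    simp only [T, Finset.coe_product, Set.mem_prod, Finset.coe_range, Set.mem_Iio] at h h'
    have h1 : j + r * l ≡ j' + r * l' [MOD d] := heq
    have h2 : j ≡ j' [MOD d.gcd r] := by
      have h3 := h1.of_dvd (Nat.gcd_dvd_left d r)
      have h4 : ∀ m, r * m ≡ 0 [MOD d.gcd r] := fun m =>
        Nat.modEq_zero_iff_dvd.2 ((Nat.gcd_dvd_right d r).mul_right m)
      exact (Nat.ModEq.add_left j (h4 l)).symm.trans (h3.trans (Nat.ModEq.add_left j' (h4 l')))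
    have hj : j = j' := h2.eq_of_lt_of_lt h.1 h'.1
    subst hj
    have h5 : l ≡ l' [MOD d / d.gcd r] :=
      (Nat.ModEq.add_left_cancel' j h1).cancel_left_div_gcd hd
    exact Prod.ext rfl (h5.eq_of_lt_of_lt h.2 h'.2)
  have himg : T.image e = Finset.range d := by
    refine Finset.eq_of_subset_of_card_le (fun i hi => ?_) ?_
    · obtain ⟨p, -, rfl⟩ := Finset.mem_image.1 hi
      exact Finset.mem_range.2 (Nat.mod_lt _ hd)
    · rw [Finset.card_image_of_injOn hinj, Finset.card_product, Finset.card_range,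
        Finset.card_range, Finset.card_range, Nat.mul_div_cancel' (Nat.gcd_dvd_left d r)]
  rw [← himg, Finset.prod_image hinj, Finset.prod_product]
  exact Finset.prod_congr rfl fun j _ => Finset.prod_congr rfl fun l _ => (hψ.map_mod_nat _).symm

/-! ### Power maps on finite fields. -/

section FiniteField

variable (k K : Type*) [Field k] [Field K] [Algebra k K] [Finite K]

theorem finrank_dvd_of_forall_pow_eq {i : ℕ} (h : ∀ x : K, x ^ Nat.card k ^ i = x) :
    Module.finrank k K ∣ i := by
  have := Finite.of_injective _ (algebraMap k K).injective
  have := Fintype.ofFinite k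
  rw [← FiniteField.orderOf_frobeniusAlgHom k K]
  refine orderOf_dvd_of_pow_eq_one (AlgHom.ext fun x => ?_)
  rw [AlgHom.coe_pow, FiniteField.coe_frobeniusAlgHom, pow_iterate, ← Nat.card_eq_fintype_card]
  exact h x

theorem modEq_finrank_of_forall_pow_eq {i j : ℕ}
    (h : ∀ x : K, x ^ Nat.card k ^ i = x ^ Nat.card k ^ j) :
    i ≡ j [MOD Module.finrank k K] := by
  have := Finite.of_injective _ (algebraMap k K).injective
  have := Fintype.ofFinite k
  rw [← FiniteField.orderOf_frobeniusAlgEquivOfAlgebraic,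
    ← pow_eq_pow_iff_modEq]
  refine AlgEquiv.ext fun x => ?_
  simpa [pow_iterate, FiniteField.coe_frobeniusAlgEquivOfAlgebraic,
    ← Nat.card_eq_fintype_card] using h x

variable {k K} in
theorem exists_forall_eq_pow (f : K →ₐ[k] K) : ∃ i : ℕ, ∀ x, f x = x ^ Nat.card k ^ i := by
  have := Finite.of_injective _ (algebraMap k K).injective
  have := Fintype.ofFinite k
  obtain ⟨i, hi⟩ := (FiniteField.bijective_frobeniusAlgHom_pow k K).2 f
  refine ⟨i, fun x => ?_⟩
  rw [← hi, AlgHom.coe_pow, FiniteField.coe_frobeniusAlgHom, pow_iterate, Nat.card_eq_fintype_card]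

end FiniteField

/-! ### Decomposition of places in constant field extensions. -/

section ConstantExtension

variable {k L L' : Type*} [Field k] [Field L] [Field L'] [Algebra k L'] [Algebra L L']

theorem IsConstantExtension.algEquiv_ext (h : IsConstantExtension k L L') {σ τ : L' ≃ₐ[L] L'}
    (hστ : ∀ c ∈ algebraicClosure k L', σ c = τ c) : σ = τ := by
  refine AlgEquiv.ext fun x => ?_
  have hx : x ∈ IntermediateField.adjoin L (algebraicClosure k L' : Set L') := h ▸ trivial
  induction hx using IntermediateField.adjoin_induction with
  | mem x hx => exact hστ x hx
  | algebraMap x => simp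
  | add x y _ _ hx hy => simp [hx, hy]
  | inv x _ hx => simp [hx]
  | mul x y _ _ hx hy => simp [hx, hy]

theorem IsFrobenius.pow_apply {φ : L' ≃ₐ[L] L'} (h : IsFrobenius k φ) (j : ℕ) {c : L'}
    (hc : c ∈ algebraicClosure k L') : (φ ^ j) c = c ^ Nat.card k ^ j := by
  induction j with
  | zero => simp
  | succ j ih =>
    rw [pow_succ', AlgEquiv.mul_apply, ih, map_pow, h c hc, ← pow_mul, pow_succ']

theorem IsFrobenius.pow_finrank_eq_one [Finite (algebraicClosure k L')]
    {φ : L' ≃ₐ[L] L'} (h : IsFrobenius k φ)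
    (hc : IsConstantExtension k L L') : φ ^ Module.finrank k (algebraicClosure k L') = 1 := by
  refine hc.algEquiv_ext fun c hc => ?_
  have := Fintype.ofFinite (algebraicClosure k L')
  rw [h.pow_apply _ hc, ← Module.natCard_eq_pow_finrank, Nat.card_eq_fintype_card]
  exact congrArg Subtype.val (FiniteField.pow_card (⟨c, hc⟩ : algebraicClosure k L'))

variable [Algebra k L]

theorem Place.deg_pos [Finite k] [IsFunctionField k L] (P : Place k L) : 0 < P.deg :=
  Module.finrank_pos

section Residue

variable [Finite k] [IsFunctionField k L] {P : Place k L} {Q : Place k L'}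

theorem IsArtinSymbol.residue_apply {σ : L' ≃ₐ[L] L'} (h : IsArtinSymbol P σ) (hQ : Q.IsAbove P)
    {x : L'} (hx : x ∈ Q.ring) :
    σ x ∈ Q.ring ∧ Q.residue (σ x) = Q.residue x ^ Nat.card k ^ P.deg := by
  have h1 := h Q hQ x hx
  have h2 : σ x ∈ Q.ring := by
    simpa using add_mem (Q.mem_ring_of_mem_nonunits h1) (pow_mem hx P.absNorm)
  refine ⟨h2, ?_⟩
  rw [← P.natCard_residueField, ← Q.residue_pow hx]
  exact (Q.residue_eq_iff h2 (pow_mem hx _)).2 h1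

theorem IsArtinSymbol.pow_residue_apply {σ : L' ≃ₐ[L] L'} (h : IsArtinSymbol P σ)
    (hQ : Q.IsAbove P) (i : ℕ) {x : L'} (hx : x ∈ Q.ring) :
    (σ ^ i) x ∈ Q.ring ∧ Q.residue ((σ ^ i) x) = Q.residue x ^ Nat.card k ^ (P.deg * i) := by
  induction i with
  | zero => simpa using hx
  | succ i ih =>
    rw [pow_succ', AlgEquiv.mul_apply]
    obtain ⟨h1, h2⟩ := h.residue_apply hQ ih.1
    refine ⟨h1, ?_⟩
    rw [h2, ih.2, ← pow_mul, ← pow_add, mul_add, mul_one]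

theorem deg_dvd_of_forall (hQ : Q.IsAbove P) {i : ℕ}
    (h : ∀ l ∈ P.ring, Q.residue (algebraMap L L' l) ^ Nat.card k ^ i =
      Q.residue (algebraMap L L' l)) : P.deg ∣ i := by
  refine finrank_dvd_of_forall_pow_eq k P.residueField fun x => ?_
  obtain ⟨l, hl, rfl⟩ := P.exists_residue_eq x
  have hl' := hQ.mem_ring_iff.2 hl
  have h1 := h l hl
  rw [← Q.residue_pow hl', Q.residue_eq_iff (pow_mem hl' _) hl', ← map_pow, ← map_sub,
    hQ.mem_nonunits_iff, ← P.residue_eq_iff (pow_mem hl _) hl, P.residue_pow hl] at h1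
  exact h1

/-- Let f be the residue degree over the constants, so the degree over k is r f. It is divisible by
deg P and by r. Conversely φ to the power lcm(deg P, r) is trivial and acts on the residue field as
the corresponding q-power map, so r f divides the lcm. -/
theorem finrank_residueField_eq [Finite (algebraicClosure k L')] [IsFunctionField k L']
    {φ : L' ≃ₐ[L] L'} (hφ : IsFrobenius k φ) (hc : IsConstantExtension k L L')
    (hA : IsArtinSymbol P (φ ^ P.deg)) (hQ : Q.IsAbove P) :
    Module.finrank (algebraicClosure k L') Q.residueField =
      P.deg / P.deg.gcd (Module.finrank k (algebraicClosure k L')) := by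
  set r := Module.finrank k (algebraicClosure k L') with hr
  set f := Module.finrank (algebraicClosure k L') Q.residueField with hf
  have : Module.Finite k (algebraicClosure k L') := .of_finite
  have hr0 : 0 < r := Module.finrank_pos
  have hcard : Nat.card Q.residueField = Nat.card k ^ (r * f) := by
    rw [Module.natCard_eq_pow_finrank (K := algebraicClosure k L'),
      Module.natCard_eq_pow_finrank (K := k) (V := algebraicClosure k L'), ← pow_mul]
  have hD : Module.finrank k Q.residueField = r * f := by
    have h1 := hcard
    rw [Module.natCard_eq_pow_finrank (K := k)] at h1
    exact Nat.pow_right_injective Finite.one_lt_card h1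
  have h1 : P.deg ∣ r * f := by
    refine deg_dvd_of_forall hQ fun l _ => ?_
    have := Fintype.ofFinite Q.residueField
    rw [← hcard, Nat.card_eq_fintype_card, FiniteField.pow_card]
  have h2 : r * f ∣ P.deg.lcm r := by
    rw [← hD]
    refine finrank_dvd_of_forall_pow_eq k Q.residueField fun x => ?_
    obtain ⟨x, hx, rfl⟩ := Q.exists_residue_eq x
    obtain ⟨i, hi⟩ := Nat.dvd_lcm_left P.deg r
    obtain ⟨j, hj⟩ := Nat.dvd_lcm_right P.deg r
    have h3 := (hA.pow_residue_apply hQ i hx).2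
    rw [← pow_mul, ← hi] at h3
    rw [← h3, hj, pow_mul, hφ.pow_finrank_eq_one hc, one_pow]
    rfl
  have h3 : r * f = P.deg.lcm r :=
    Nat.dvd_antisymm h2 (Nat.lcm_dvd h1 (dvd_mul_right r f))
  refine Nat.eq_of_mul_eq_mul_left hr0 ?_
  rw [h3, Nat.lcm, mul_comm, Nat.mul_div_assoc _ (Nat.gcd_dvd_left _ _)]

end Residue

variable [IsScalarTower k L L']

theorem IsArtinSymbol.smul_eq [Finite k] [IsFunctionField k L] [IsFunctionField k L']
    {P : Place k L} {Q : Place k L'} {σ : L' ≃ₐ[L] L'} (h : IsArtinSymbol P σ) (hQ : Q.IsAbove P) :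
    σ⁻¹ • Q = Q := by
  refine (Place.eq_of_ring_le fun x hx => ?_).symm
  rw [Place.mem_smul_ring_iff, inv_inv]
  exact (h.residue_apply hQ hx).1

theorem map_mem_algebraicClosure (σ : L' ≃ₐ[L] L') {c : L'} (hc : c ∈ algebraicClosure k L') :
    σ c ∈ algebraicClosure k L' :=
  mem_algebraicClosure_iff.2 ((isAlgebraic_algHom_iff (σ.restrictScalars k).toAlgHom
    σ.injective).2 (mem_algebraicClosure_iff.1 hc))

theorem finite_algebraicClosure (Q : Place k L') [Finite k] [IsFunctionField k L'] :
    Finite (algebraicClosure k L') :=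
  Finite.of_injective _ (algebraMap (algebraicClosure k L') Q.residueField).injective

variable [Finite (algebraicClosure k L')]

theorem IsFrobenius.exists_pow_eq {φ : L' ≃ₐ[L] L'} (h : IsFrobenius k φ)
    (hc : IsConstantExtension k L L') (σ : L' ≃ₐ[L] L') : ∃ i : ℕ, σ = φ ^ i := by
  let f : algebraicClosure k L' →ₐ[k] algebraicClosure k L' :=
    ((σ.restrictScalars k).toAlgHom.comp (algebraicClosure k L').val).codRestrict
      (algebraicClosure k L').toSubalgebra fun c => map_mem_algebraicClosure σ c.2
  obtain ⟨i, hi⟩ := exists_forall_eq_pow f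
  refine ⟨i, hc.algEquiv_ext fun c hc => ?_⟩
  rw [h.pow_apply i hc]
  exact congrArg Subtype.val (hi ⟨c, hc⟩)

variable [Finite k] [IsFunctionField k L] [IsFunctionField k L'] {P : Place k L} {Q : Place k L'}
  {φ : L' ≃ₐ[L] L'}

/-- By Bézout, since φ^{deg P} stabilizes Q and φ^r = 1. -/
theorem pow_gcd_smul_eq (hφ : IsFrobenius k φ) (hc : IsConstantExtension k L L')
    (hA : IsArtinSymbol P (φ ^ P.deg)) (hQ : Q.IsAbove P) :
    (φ ^ P.deg.gcd (Module.finrank k (algebraicClosure k L'))) • Q = Q := by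
  have h1 : φ ^ P.deg ∈ MulAction.stabilizer (L' ≃ₐ[L] L') Q :=
    inv_mem_iff.1 (MulAction.mem_stabilizer_iff.2 (hA.smul_eq hQ))
  rw [← MulAction.mem_stabilizer_iff, ← zpow_natCast, Nat.gcd_eq_gcd_ab, zpow_add, zpow_mul,
    zpow_mul, zpow_natCast, zpow_natCast, hφ.pow_finrank_eq_one hc, one_zpow, mul_one]
  exact zpow_mem h1 _

/-- An element φ^j of the stabilizer induces some q^i-power map on the residue field. It fixes the
residue field of P, so deg P divides i; comparing actions on constants gives i ≡ j mod r. -/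
theorem gcd_dvd_of_pow_smul_eq (hφ : IsFrobenius k φ) (hQ : Q.IsAbove P) {j : ℕ}
    (hj : (φ ^ j) • Q = Q) :
    P.deg.gcd (Module.finrank k (algebraicClosure k L')) ∣ j := by
  have hmem : ∀ x ∈ Q.ring, (φ ^ j) x ∈ Q.ring := fun x hx => by
    rw [← hj, Place.mem_smul_ring_iff, ← AlgEquiv.mul_apply, inv_mul_cancel]
    exact hx
  have hnon : ∀ x ∈ Q.ring.nonunits, (φ ^ j) x ∈ Q.ring.nonunits := fun x hx => by
    rw [← hj, Place.mem_smul_nonunits_iff, ← AlgEquiv.mul_apply, inv_mul_cancel]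
    exact hx
  let g : Q.ring →+* Q.residueField := (IsLocalRing.residue Q.ring).comp
    (((φ ^ j : L' ≃ₐ[L] L') : L' →+* L').restrict Q.ring Q.ring hmem)
  let f : Q.residueField →+* Q.residueField := Ideal.Quotient.lift (maximalIdeal Q.ring) g
    fun x hx => by
      refine (IsLocalRing.residue_eq_zero_iff _).2 (Q.ring.coe_mem_nonunits_iff.1 ?_)
      exact hnon x (Q.ring.coe_mem_nonunits_iff.2 hx)
  have hf : ∀ x ∈ Q.ring, f (Q.residue x) = Q.residue ((φ ^ j) x) := by
    intro x hx
    rw [Q.residue_of_mem hx, Q.residue_of_mem (hmem x hx)]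
    rfl
  have hk : ∀ a : k, (algebraMap k Q.residueField a) = Q.residue (algebraMap k L' a) :=
    fun a => (Q.residue_of_mem (Q.2.2 a)).symm
  let fk : Q.residueField →ₐ[k] Q.residueField :=
    { f with
      commutes' := fun a => by
        change f _ = _
        rw [hk, hf _ (Q.2.2 a), IsScalarTower.algebraMap_apply k L L', AlgEquiv.commutes] }
  obtain ⟨i, hi⟩ := exists_forall_eq_pow fk
  have hi' : ∀ x ∈ Q.ring, Q.residue ((φ ^ j) x) = Q.residue x ^ Nat.card k ^ i := fun x hx =>
    (hf x hx).symm.trans (hi _)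
  have h1 : P.deg ∣ i := deg_dvd_of_forall hQ fun l hl => by
    rw [← hi' _ (hQ.mem_ring_iff.2 hl), AlgEquiv.commutes]
  have h2 : i ≡ j [MOD Module.finrank k (algebraicClosure k L')] := by
    refine modEq_finrank_of_forall_pow_eq k _ fun c => Subtype.ext ?_
    refine Q.residue_const_injective (SetLike.coe_mem _) (SetLike.coe_mem _) ?_
    have h3 := hi' c (Q.const_mem c)
    rw [hφ.pow_apply j c.2, ← Q.residue_pow (Q.const_mem c)] at h3
    exact h3.symm
  have h3 := h2.of_dvd (Nat.gcd_dvd_right P.deg _)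
  exact (Nat.modEq_zero_iff_dvd).1 (h3.symm.trans
    (Nat.modEq_zero_iff_dvd.2 ((Nat.gcd_dvd_left _ _).trans h1)))

theorem prod_isAbove_eq_prod_range [FiniteDimensional L L'] [IsGalois L L'] {M : Type*}
    [CommMonoid M] (hφ : IsFrobenius k φ) (hc : IsConstantExtension k L L')
    (hA : IsArtinSymbol P (φ ^ P.deg)) (hQ : Q.IsAbove P) (w : Place k L' → M)
    {S : Finset (Place k L')} (hS : ∀ R, R ∈ S ↔ R.IsAbove P) :
    ∏ R ∈ S, w R =
      ∏ j ∈ Finset.range (P.deg.gcd (Module.finrank k (algebraicClosure k L'))),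
        w ((φ ^ j) • Q) := by
  classical
  set g := P.deg.gcd (Module.finrank k (algebraicClosure k L')) with hg
  have hg0 : 0 < g := Nat.gcd_pos_of_pos_left _ P.deg_pos
  have hinj : Set.InjOn (fun j : ℕ => (φ ^ j) • Q) (Finset.range g) := by
    have key : ∀ i j : ℕ, i ≤ j → j < g → (φ ^ i) • Q = (φ ^ j) • Q → i = j := by
      intro i j hij hj h
      obtain ⟨m, rfl⟩ := Nat.exists_eq_add_of_le hij
      rw [pow_add, mul_smul] at h
      have h1 := gcd_dvd_of_pow_smul_eq hφ hQ (MulAction.injective _ h).symm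
      have := Nat.eq_zero_of_dvd_of_lt h1 (by omega)
      omega
    intro i hi j hj h
    have hi' := Finset.mem_range.1 hi
    have hj' := Finset.mem_range.1 hj
    rcases le_total i j with hij | hij
    · exact key i j hij hj' h
    · exact (key j i hij hi' h.symm).symm
  have himg : (Finset.range g).image (fun j : ℕ => (φ ^ j) • Q) = S := by
    ext R
    rw [hS, Finset.mem_image]
    constructor
    · rintro ⟨j, -, rfl⟩
      exact hQ.smul _
    · intro hR
      obtain ⟨σ, rfl⟩ := hQ.exists_smul_eq hR
      obtain ⟨i, rfl⟩ := hφ.exists_pow_eq hc σ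
      refine ⟨i % g, Finset.mem_range.2 (Nat.mod_lt _ hg0), ?_⟩
      conv_rhs => rw [← Nat.mod_add_div i g]
      have h1 : (φ ^ g) ^ (i / g) ∈ MulAction.stabilizer (L' ≃ₐ[L] L') Q :=
        pow_mem (MulAction.mem_stabilizer_iff.2 (pow_gcd_smul_eq hφ hc hA hQ)) _
      rw [pow_add, mul_smul, pow_mul, MulAction.mem_stabilizer_iff.1 h1]
  rw [← himg, Finset.prod_image hinj]

/-- The product of the norms of `h` at the places above `P`, modulo one of these places. -/
theorem residue_prod_norm [FiniteDimensional L L'] [IsGalois L L']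
    (hφ : IsFrobenius k φ) (hc : IsConstantExtension k L L')
    (hA : IsArtinSymbol P (φ ^ P.deg)) (hQ : Q.IsAbove P)
    {S : Finset (Place k L')} (hS : ∀ R, R ∈ S ↔ R.IsAbove P) {h : L'}
    (hh : ∀ R : Place k L', R.IsAbove P → h ∈ R.ring) :
    Q.residue ((∏ R ∈ S, Algebra.norm (algebraicClosure k L') (R.residue h) :
      algebraicClosure k L') : L') =
      ∏ j ∈ Finset.range P.deg, Q.residue ((φ ^ j)⁻¹ h) ^ Nat.card k ^ j := by
  have : Module.Finite k (algebraicClosure k L') := .of_finite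
  have hmem : ∀ σ : L' ≃ₐ[L] L', σ⁻¹ h ∈ Q.ring := fun σ =>
    (Place.mem_smul_ring_iff σ Q).1 (hh _ (hQ.smul σ))
  -- Raising to the power q^{deg P} modulo `Q` is the action of φ^{deg P}, which cancels the shift
  -- in the index.
  have hper : Function.Periodic (fun j => Q.residue ((φ ^ j)⁻¹ h) ^ Nat.card k ^ j) P.deg := by
    intro j
    have h1 := (hA.residue_apply hQ (hmem (φ ^ (j + P.deg)))).2
    have h2 : (φ ^ P.deg) ((φ ^ (j + P.deg))⁻¹ h) = (φ ^ j)⁻¹ h := by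
      rw [← AlgEquiv.mul_apply]
      congr 1
      rw [add_comm j, pow_add]
      group
    rw [h2] at h1
    simp only
    rw [h1, ← pow_mul, ← pow_add, add_comm j]
  rw [← prod_range_gcd_prod_range _ P.deg_pos (Module.finrank k (algebraicClosure k L')) hper,
    prod_isAbove_eq_prod_range hφ hc hA hQ _ hS]
  rw [← (algebraicClosure k L').val_apply, map_prod, Q.residue_prod]
  swap
  · exact fun j _ => Q.const_mem _
  refine Finset.prod_congr rfl fun j _ => ?_
  set R := (φ ^ j) • Q with hR
  have hRP : R.IsAbove P := hQ.smul _
  set a := Algebra.norm (algebraicClosure k L') (R.residue h) with ha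
  have h1 : R.residue (a : L') = R.residue (∏ l ∈ Finset.range (P.deg / P.deg.gcd
      (Module.finrank k (algebraicClosure k L'))),
        h ^ Nat.card k ^ (Module.finrank k (algebraicClosure k L') * l)) := by
    rw [R.residue_const, ha, FiniteField.algebraMap_norm_eq_prod_pow,
      finrank_residueField_eq hφ hc hA hRP, R.residue_prod _ _ fun l _ => pow_mem (hh R hRP) _]
    refine Finset.prod_congr rfl fun l _ => ?_
    rw [R.residue_pow (hh R hRP), Module.natCard_eq_pow_finrank (K := k)
      (V := algebraicClosure k L'), ← pow_mul]
  -- Applying φ^{-j} moves the congruence from `R` = φ^j Q to `Q`.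
  rw [R.residue_eq_iff (R.const_mem a) (prod_mem fun l _ => pow_mem (hh R hRP) _), hR,
    Place.mem_smul_nonunits_iff, map_sub, map_prod] at h1
  simp only [map_pow] at h1
  have hac := map_mem_algebraicClosure (φ ^ j)⁻¹ a.2
  rw [← Q.residue_eq_iff (Q.const_mem ⟨_, hac⟩) (prod_mem fun l _ => pow_mem (hmem _) _),
    Q.residue_prod _ _ fun l _ => pow_mem (hmem _) _] at h1
  -- The norm is a constant, so φ^j acts on it as the q^j-power map; this produces the exponents
  -- q^j.
  have h2 : (a : L') = ((φ ^ j)⁻¹ (a : L')) ^ Nat.card k ^ j := by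
    rw [← hφ.pow_apply j hac, ← AlgEquiv.mul_apply, mul_inv_cancel, AlgEquiv.one_apply]
  have h4 : Q.residue ((algebraicClosure k L').val a) =
      Q.residue ((φ ^ j)⁻¹ (a : L')) ^ Nat.card k ^ j := by
    rw [← Q.residue_pow (Q.const_mem ⟨_, hac⟩), ← h2]
    rfl
  refine h4.trans ?_
  rw [h1, ← Finset.prod_pow]
  refine Finset.prod_congr rfl fun l _ => ?_
  rw [Q.residue_pow (hmem _), ← pow_mul, ← pow_add]
  have h3 : φ ^ (j + Module.finrank k (algebraicClosure k L') * l) = φ ^ j := by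
    rw [pow_add, pow_mul, hφ.pow_finrank_eq_one hc, one_pow, mul_one]
  rw [h3, add_comm j]

end ConstantExtension

/-! ### The local computation of the Artin symbol on a Kummer generator. -/

section Kummer

variable {k F E : Type*} [Field k] [Field F] [Field E] [Algebra k F] [Algebra k E] [Algebra F E]
  [IsScalarTower k F E] {F' : IntermediateField F E}

theorem isScalarTower_base (k : Type*) {F E : Type*} [Field k] [Field F] [Field E] [Algebra k F]
    [Algebra k E] [Algebra F E] [IsScalarTower k F E] (F' : IntermediateField F E) :
    IsScalarTower k F' E := .of_algebraMap_eq fun _ => rfl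

attribute [local instance] isScalarTower_base

theorem coe_mem_algebraicClosure_iff {c : F'} :
    (c : E) ∈ algebraicClosure k E ↔ c ∈ algebraicClosure k F' := by
  rw [mem_algebraicClosure_iff, mem_algebraicClosure_iff]
  exact isAlgebraic_algebraMap_iff (algebraMap F' E).injective

theorem exists_extendsFrobenius [Finite k] [FiniteDimensional F E] [IsAbelianGalois F E]
    (hF : algebraicClosure k F = ⊥) (F' : IntermediateField F E) :
    ∃ σ : E ≃ₐ[F] E, ExtendsFrobenius k F' σ := by
  obtain ⟨σ, hσ⟩ := exists_frobenius_on_constants (k := k) (L := F) (L' := E) hF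
  have hres : ∀ x : F', σ x = (σ.restrictNormal F' x : F') := fun x =>
    (σ.restrictNormal_commutes F' x).symm
  refine ⟨σ, σ.restrictNormal F', fun c hc => Subtype.ext ?_, hres⟩
  rw [← hres]
  exact hσ _ (coe_mem_algebraicClosure_iff.2 hc)

theorem mem_algebraicClosure_of_pow_eq_one {L : Type*} [Field L] [Algebra k L] {n : ℕ} (hn : n ≠ 0)
    {c : L} (hc : c ^ n = 1) : c ∈ algebraicClosure k L :=
  mem_algebraicClosure_iff.2 ((IsIntegral.of_pow (Nat.pos_of_ne_zero hn)
    (hc ▸ isIntegral_one)).isAlgebraic)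

theorem exists_coe_eq_of_pow_eq_one {n : ℕ} (hn : n ≠ 0) (hμ : ∃ ζ : F', IsPrimitiveRoot ζ n)
    {u : E} (hu : u ^ n = 1) : ∃ c : F', (c : E) = u ∧ c ^ n = 1 := by
  obtain ⟨ζ, hζ⟩ := hμ
  have : NeZero n := ⟨hn⟩
  obtain ⟨i, -, rfl⟩ := (hζ.map_of_injective (algebraMap F' E).injective).eq_pow_of_pow_eq_one hu
  exact ⟨ζ ^ i, by simp, by rw [← pow_mul, mul_comm, pow_mul, hζ.pow_eq_one, one_pow]⟩

theorem coe_pow_apply {σ : E ≃ₐ[F] E} {φ : F' ≃ₐ[F] F'} (h : ∀ x : F', σ x = φ x) (j : ℕ) (x : F') :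
    (σ ^ j) (x : E) = ((φ ^ j) x : F') := by
  induction j with
  | zero => simp
  | succ j ih => rw [pow_succ', AlgEquiv.mul_apply, ih, h, pow_succ', AlgEquiv.mul_apply]

theorem coe_inv_apply {σ : E ≃ₐ[F] E} {φ : F' ≃ₐ[F] F'} (h : ∀ x : F', σ x = φ x) (x : F') :
    σ⁻¹ (x : E) = (φ⁻¹ x : F') := by
  apply σ.injective
  rw [h, ← AlgEquiv.mul_apply, ← AlgEquiv.mul_apply, mul_inv_cancel, mul_inv_cancel]
  rfl

/-- Telescoping: the factor of index j equals (σ^{-(j+1)} y)^{q^{j+1}} / (σ^{-j} y)^{q^j}. -/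
theorem prod_range_frobenius_quotient {φ : F' ≃ₐ[F] F'} {σ : E ≃ₐ[F] E} {y : E} {h : F'} {q : ℕ}
    (hσ : ∀ x : F', σ x = φ x) (hy : y ≠ 0)
    (hh : (h : E) = (σ⁻¹ y) ^ q * y⁻¹) (d : ℕ) :
    ((∏ j ∈ Finset.range d, ((φ ^ j)⁻¹ h) ^ q ^ j : F') : E) * y = ((σ ^ d)⁻¹ y) ^ q ^ d := by
  induction d with
  | zero => simp
  | succ d ih =>
    have h1 : (((φ ^ d)⁻¹ h : F') : E) = ((σ ^ (d + 1))⁻¹ y) ^ q * ((σ ^ d)⁻¹ y)⁻¹ := by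
      rw [← coe_inv_apply (coe_pow_apply hσ d), hh, map_mul, map_pow, map_inv₀,
        ← AlgEquiv.mul_apply, ← mul_inv_rev, ← pow_succ']
    have h0 : (σ ^ d)⁻¹ y ≠ 0 := (map_ne_zero_iff _ (σ ^ d)⁻¹.injective).2 hy
    rw [Finset.prod_range_succ]
    push_cast at ih ⊢
    rw [h1, mul_right_comm, ih, mul_pow, ← pow_mul, ← pow_succ', mul_comm, mul_assoc, ← mul_pow,
      inv_mul_cancel₀ h0, one_pow, mul_one]

theorem IsArtinSymbol.restrict {P : Place k F} {ρ : E ≃ₐ[F] E} (hρ : IsArtinSymbol P ρ)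
    {χ : F' ≃ₐ[F] F'} (h : ∀ x : F', ρ x = χ x) : IsArtinSymbol P χ := by
  intro Q hQ x hx
  obtain ⟨R, hR⟩ := Q.exists_isAbove (L' := E)
  have h1 := hρ R (hR.trans hQ) (algebraMap F' E x) (hR.mem_ring_iff.2 hx)
  have h2 : ρ (algebraMap F' E x) = algebraMap F' E (χ x) := h x
  rw [h2, ← map_pow, ← map_sub, hR.mem_nonunits_iff] at h1
  exact h1

/-- On constants the Artin congruence is an equality, and constants generate `F'` over F. -/
theorem IsArtinSymbol.apply_eq_pow [Finite k] [IsFunctionField k F]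
    [IsAbelianGalois F E] {P : Place k F} {ρ : E ≃ₐ[F] E} {φ : F' ≃ₐ[F] F'} (hρ : IsArtinSymbol P ρ)
    (hF' : IsConstantExtension k F F') (hφ : IsFrobenius k φ) (x : F') : ρ x = ((φ ^ P.deg) x : F') := by
  have hres : ∀ x : F', ρ x = (ρ.restrictNormal F' x : F') := fun x =>
    (ρ.restrictNormal_commutes F' x).symm
  rw [hres]
  congr 2
  refine hF'.algEquiv_ext fun c hc => ?_
  obtain ⟨Q, hQ⟩ := P.exists_isAbove (L' := F')
  rw [hφ.pow_apply _ hc]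
  refine Q.residue_const_injective (map_mem_algebraicClosure _ hc) (pow_mem hc _) ?_
  rw [((hρ.restrict hres).residue_apply hQ (Q.const_mem ⟨c, hc⟩)).2,
    Q.residue_pow (Q.const_mem ⟨c, hc⟩)]

/-- The n-th power of g⁻¹ y is a conjugate of f, hence a unit at R because the Galois group permutes
the places above P; the value group has no torsion. -/
theorem valuation_inv_apply_eq_one {P : Place k F} [IsAbelianGalois F E] {n : ℕ} (hn : n ≠ 0) {f : F'}
    {y : E} (hf : (f : E) = y ^ n)
    (hfP : ∀ Q : Place k F', Q.IsAbove P → Q.ring.valuation f = 1) {R : Place k E} {Q : Place k F'}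
    (hR : R.IsAbove Q) (hQ : Q.IsAbove P) (g : E ≃ₐ[F] E) : R.ring.valuation (g⁻¹ y) = 1 := by
  have h1 : R.ring.valuation ((g⁻¹ y) ^ n) = 1 := by
    rw [← map_pow, ← hf]
    have h2 : ∀ x : F', g x = (g.restrictNormal F' x : F') := fun x =>
      (g.restrictNormal_commutes F' x).symm
    rw [coe_inv_apply h2]
    refine (hR.valuation_eq_one_iff (x := (g.restrictNormal F')⁻¹ f)).2 ?_
    rw [← Place.valuation_smul_eq_one_iff]
    exact hfP _ (hQ.smul _)
  rw [map_pow] at h1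
  exact (pow_eq_one_iff_of_nonneg zero_le hn).1 h1

variable [Finite k] [IsFunctionField k F] [IsFunctionField k F']

section Artin

variable [FiniteDimensional F E] {P : Place k F} {ρ : E ≃ₐ[F] E}

variable {φ : F' ≃ₐ[F] F'} [IsAbelianGalois F E]

variable {σ : E ≃ₐ[F] E} {n : ℕ} {y : E} {f h : F'}

/-- The local form of the theorem: the root of unity by which ρ σ^{-deg P} multiplies y and the
product of norms of h are constants with the same residue at one place above P. -/
theorem exists_artinSymbol_apply_eq (hF' : IsConstantExtension k F F') (hn : n ≠ 0)
    (hμ : ∃ ζ : F', IsPrimitiveRoot ζ n) (hρ : IsArtinSymbol P ρ) (hφ : IsFrobenius k φ)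
    (hσ : ∀ x : F', σ x = φ x) (hy : y ≠ 0) (hf : (f : E) = y ^ n)
    (hfP : ∀ Q : Place k F', Q.IsAbove P → Q.ring.valuation f = 1)
    (hh : (h : E) = (σ⁻¹ y) ^ Nat.card k * y⁻¹)
    (hhP : ∀ Q : Place k F', Q.IsAbove P → Q.ring.valuation h = 1)
    {S : Finset (Place k F')} (hS : ∀ R, R ∈ S ↔ R.IsAbove P) :
    (∀ x : F', (ρ * (σ ^ P.deg)⁻¹) x = x) ∧
    ((∏ R ∈ S, Algebra.norm (algebraicClosure k F') (R.residue h) :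
      algebraicClosure k F') : F') ^ n = 1 ∧
    (ρ * (σ ^ P.deg)⁻¹) y = (((∏ R ∈ S, Algebra.norm (algebraicClosure k F') (R.residue h) :
      algebraicClosure k F') : F') : E) * y := by
  have hρφ := hρ.apply_eq_pow hF' hφ
  have hfix : ∀ x : F', (ρ * (σ ^ P.deg)⁻¹) x = x := fun x => by
    rw [AlgEquiv.mul_apply, coe_inv_apply (coe_pow_apply hσ P.deg), hρφ, ← AlgEquiv.mul_apply,
      mul_inv_cancel, AlgEquiv.one_apply]
  set τ := ρ * (σ ^ P.deg)⁻¹ with hτ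
  obtain ⟨c, hc, hcn⟩ := exists_coe_eq_of_pow_eq_one hn hμ (u := τ y * y⁻¹) (by
    rw [mul_pow, ← map_pow, ← hf, hfix, hf, inv_pow, mul_inv_cancel₀ (pow_ne_zero n hy)])
  have hcy : τ y = c * y := by rw [hc, inv_mul_cancel_right₀ hy]
  obtain ⟨R, hR⟩ := P.exists_isAbove (L' := E)
  obtain ⟨Q, hRQ⟩ := R.exists_place_below (L := F')
  have hQ : Q.IsAbove P := hRQ.of_trans hR
  have := finite_algebraicClosure Q
  have hA : IsArtinSymbol P (φ ^ P.deg) := hρ.restrict hρφ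
  have hval := valuation_inv_apply_eq_one hn hf hfP hRQ hQ
  have hvy : R.ring.valuation y = 1 := hval 1
  set Z : F' := ∏ j ∈ Finset.range P.deg, ((φ ^ j)⁻¹ h) ^ Nat.card k ^ j with hZ
  have hhm : ∀ j, (φ ^ j)⁻¹ h ∈ Q.ring := fun j =>
    (Place.mem_smul_ring_iff _ Q).1 ((Place.valuation_eq_one_iff_mem _).1 (hhP _ (hQ.smul _))).1
  have hcZ : Q.residue c = Q.residue Z := by
    -- The Artin congruence at σ^{-deg P}(y); since y is a unit at `R`, it can be cancelled after
    -- telescoping.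
    have h1 : ρ ((σ ^ P.deg)⁻¹ y) - ((σ ^ P.deg)⁻¹ y) ^ P.absNorm ∈ R.ring.nonunits :=
      hρ R hR _ ((Place.valuation_eq_one_iff_mem _).1 (hval _)).1
    rw [← AlgEquiv.mul_apply, ← hτ, hcy, Place.absNorm, P.natCard_residueField,
      ← prod_range_frobenius_quotient hσ hy hh, ← hZ, ← sub_mul,
      ValuationSubring.mem_nonunits_iff, map_mul, hvy, mul_one] at h1
    rw [Q.residue_eq_iff (Q.const_mem ⟨c, mem_algebraicClosure_of_pow_eq_one hn hcn⟩)
      (prod_mem fun j _ => pow_mem (hhm j) _), ← hRQ.mem_nonunits_iff]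
    exact h1
  have hceq : c = (∏ R ∈ S, Algebra.norm (algebraicClosure k F') (R.residue h) :
      algebraicClosure k F') := by
    refine Q.residue_const_injective (mem_algebraicClosure_of_pow_eq_one hn hcn)
      (SetLike.coe_mem _) ?_
    rw [hcZ, residue_prod_norm hφ hF' hA hQ hS fun R hR =>
      ((Place.valuation_eq_one_iff_mem _).1 (hhP _ hR)).1, hZ,
      Q.residue_prod _ _ fun j _ => pow_mem (hhm j) _]
    exact Finset.prod_congr rfl fun j _ => Q.residue_pow (hhm j) _
  rw [← hceq]
  exact ⟨hfix, hcn, hcy⟩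

end Artin

end Kummer

/-! ### Kummer generators and the support of the conorm. -/

section Selmer

attribute [local instance] isScalarTower_base

theorem notMem_support_of_mem {k L : Type*} [Field k] [Field L] [Algebra k L] {m D : Divisor k L}
    (hD : D ∈ divisorsAway m) {P : Place k L} (hP : P ∈ D.support) :
    P ∉ m.support := fun h => Finsupp.mem_support_iff.1 hP (hD P h)


variable {k F E : Type*} [Field k] [Field F] [Field E] [Algebra k F] [Algebra k E] [Algebra F E]
  [IsScalarTower k F E] {F' : IntermediateField F E} [Finite k] [IsFunctionField k F]
  [IsFunctionField k F'] [IsFunctionField k E] {m D : Divisor k F}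

theorem IsUnramifiedOutside.ramIndex_eq_one (hunr : IsUnramifiedOutside E m) {P : Place k F}
    (hP : P ∉ m.support) {R : Place k E} {Q : Place k F'} (hR : R.IsAbove Q) (hQ : Q.IsAbove P) :
    ramIndex R Q = 1 ∧ ramIndex Q P = 1 := by
  have h := hunr P hP R (hR.trans hQ)
  rw [ramIndex_mul hR hQ] at h
  exact mul_eq_one.1 h

/-- For R above an unramified Q, the order of f at Q equals its order at R, which is n times that of
y. -/
theorem dvd_ord_of_coe_eq_pow [Algebra.IsAlgebraic F F'] (hunr : IsUnramifiedOutside E m)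
    {n : ℕ} {f : F'} {y : E}
    (hy : y ≠ 0) (hf : (f : E) = y ^ n) {Q : Place k F'} (hQ : ∀ P ∈ m.support, ¬ Q.IsAbove P) :
    (n : ℤ) ∣ Q.ord f := by
  obtain ⟨P, hP⟩ := Q.exists_place_below (L := F)
  obtain ⟨R, hR⟩ := Q.exists_isAbove (L' := E)
  have h1 := (hunr.ramIndex_eq_one (fun h => hQ P h hP) hR hP).1
  have hf0 : f ≠ 0 := fun h => pow_ne_zero n hy (by rw [← hf, h]; rfl)
  have h2 := ord_algebraMap hR hf0
  rw [h1, Nat.cast_one, one_mul] at h2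
  refine ⟨R.ord y, ?_⟩
  rw [← h2, ← R.ord_pow hy, ← hf]
  rfl

variable [FiniteDimensional F E] [IsAbelianGalois F E]

theorem mem_support_conorm_iff (hunr : IsUnramifiedOutside E m) (hD : D ∈ divisorsAway m)
    {Q : Place k F'} {P : Place k F} (hQ : Q.IsAbove P) :
    Q ∈ (conorm F' D).support ↔ P ∈ D.support := by
  rw [Finsupp.mem_support_iff, Finsupp.mem_support_iff, conorm_apply D hQ]
  refine ⟨fun h h' => h (by simp [h']), fun h => ?_⟩
  obtain ⟨R, hR⟩ := Q.exists_isAbove (L' := E)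
  rw [(hunr.ramIndex_eq_one (notMem_support_of_mem hD (Finsupp.mem_support_iff.2 h)) hR hQ).2]
  simpa using h

theorem conorm_apply_of_mem_support (hunr : IsUnramifiedOutside E m) (hD : D ∈ divisorsAway m)
    {Q : Place k F'} {P : Place k F} (hQ : Q.IsAbove P) (hP : P ∈ D.support) :
    conorm F' D Q = D P := by
  obtain ⟨R, hR⟩ := Q.exists_isAbove (L' := E)
  rw [conorm_apply D hQ, (hunr.ramIndex_eq_one (notMem_support_of_mem hD hP) hR hQ).2, Nat.cast_one,
    mul_one]

theorem exists_isKummerGenerator (hunr : IsUnramifiedOutside E m) (hD : D ∈ divisorsAway m) {n : ℕ}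
    (hn : n ≠ 0) (hμ : ∃ ζ : F', IsPrimitiveRoot ζ n) (hcyc : IsCyclic (E ≃ₐ[F'] E))
    (hdvd : Module.finrank F' E ∣ n) : ∃ y : E, IsKummerGenerator F' n m D y := by
  obtain ⟨l, hl⟩ := hdvd
  have hprim : (primitiveRoots (Module.finrank F' E) F').Nonempty := by
    obtain ⟨ζ, hζ⟩ := hμ
    refine ⟨ζ ^ l, (mem_primitiveRoots Module.finrank_pos).2 ?_⟩
    exact hζ.pow (Nat.pos_of_ne_zero hn) (by rw [hl, mul_comm])
  have hex : ∃ y : E, y ≠ 0 ∧ (∃ f : F', (f : E) = y ^ n) ∧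
      IntermediateField.adjoin F' {y} = ⊤ := by
    obtain ⟨α, ⟨a, ha⟩, hα⟩ := exists_root_adjoin_eq_top_of_isCyclic F' E hprim
    -- A zero generator means E = F', and then 1 generates as well.
    by_cases h0 : α = 0
    · refine ⟨1, one_ne_zero, ⟨1, by simp⟩, ?_⟩
      rw [← hα, h0, IntermediateField.adjoin_zero, IntermediateField.adjoin_one]
    · refine ⟨α, h0, ⟨a ^ l, ?_⟩, hα⟩
      rw [hl, pow_mul, ← ha]
      rfl
  obtain ⟨y, hy, ⟨f, hf⟩, htop⟩ := hex
  have hf0 : f ≠ 0 := fun h => pow_ne_zero n hy (by rw [← hf, h]; rfl)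
  -- Along Con(D) the order of f is divisible by n, so the n-th power of a suitable g in `F'`
  -- cancels it.
  obtain ⟨g, hg0, hg⟩ := Place.exists_forall_ord_eq (conorm F' D).support
    fun Q => -(Q.ord f / n)
  have hgE : (g : E) ≠ 0 := by simpa using hg0
  have hgy : (g : E) * y ≠ 0 := mul_ne_zero hgE hy
  have hfg : ((g ^ n * f : F') : E) = ((g : E) * y) ^ n := by
    rw [mul_pow, ← hf]
    rfl
  have hfg0 : g ^ n * f ≠ 0 := mul_ne_zero (pow_ne_zero n hg0) hf0
  refine ⟨g * y, ?_, g ^ n * f, hfg, ⟨hfg0, fun Q hQ => dvd_ord_of_coe_eq_pow hunr hgy hfg hQ⟩,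
    hfg0, fun Q hQ => ?_⟩
  · rw [eq_top_iff, ← htop, IntermediateField.adjoin_simple_le_iff]
    have h1 : y = algebraMap F' E g⁻¹ * (g * y) := by
      rw [map_inv₀]
      exact (inv_mul_cancel_left₀ hgE y).symm
    have h2 : algebraMap F' E g⁻¹ * (g * y) ∈ IntermediateField.adjoin F' {(g : E) * y} :=
      mul_mem (algebraMap_mem _ _) (IntermediateField.mem_adjoin_simple_self F' _)
    rwa [← h1] at h2
  · obtain ⟨P, hP⟩ := Q.exists_place_below (L := F)
    have hPm := notMem_support_of_mem hD ((mem_support_conorm_iff hunr hD hP).1 hQ)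
    have hdv := dvd_ord_of_coe_eq_pow hunr hy hf (Q := Q) fun P' hP' h' => hPm (hP.unique h' ▸ hP')
    rw [Q.ord_mul (pow_ne_zero n hg0) hf0, Q.ord_pow hg0, hg Q hQ, mul_neg, Int.mul_ediv_cancel' hdv,
      neg_add_cancel]

end Selmer

/-! ### From single places to divisors. -/

section ArtinMap

variable {k F E : Type*} [Field k] [Field F] [Field E] [Algebra k F] [Algebra k E] [Algebra F E]

open scoped IsMulCommutative in
theorem artinMap_mul_inv_zpow_deg [IsAbelianGalois F E] (D : Divisor k F) (σ : E ≃ₐ[F] E) :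
    artinMap E D * (σ ^ D.deg)⁻¹ =
      ∏ P ∈ D.support, (artinSymbol E P * (σ ^ P.deg)⁻¹) ^ D P := by
  have h : σ ^ D.deg = ∏ P ∈ D.support, (σ ^ P.deg) ^ D P := by
    rw [Divisor.deg, Finsupp.sum]
    induction D.support using Finset.cons_induction with
    | empty => simp
    | cons P s hP ih =>
      rw [Finset.sum_cons, Finset.prod_cons, zpow_add, ih, mul_comm (D P), zpow_mul, zpow_natCast]
  rw [h, artinMap, Finsupp.prod, ← Finset.prod_inv_distrib, ← Finset.prod_mul_distrib]
  exact Finset.prod_congr rfl fun P _ => by rw [mul_zpow, inv_zpow]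

variable {F' : IntermediateField F E}

/-- The multiplier c lies in the fixed field `F'`, so iterating g just multiplies by powers of c. -/
theorem zpow_apply_eq {g : E ≃ₐ[F] E} {c : F'} {y : E} (hfix : ∀ x : F', g x = x) (hc : c ≠ 0)
    (hgy : g y = c * y) (i : ℤ) : (∀ x : F', (g ^ i) x = x) ∧ (g ^ i) y = ((c ^ i : F') : E) * y := by
  have hcE : (c : E) ≠ 0 := by simpa using hc
  have hinv : ∀ z : E, g z = z → g⁻¹ z = z := fun z hz => by
    apply g.injective
    rw [← AlgEquiv.mul_apply, mul_inv_cancel, hz]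
    rfl
  induction i with
  | zero => simp
  | succ i ih =>
    refine ⟨fun x => ?_, ?_⟩
    · rw [zpow_add_one, AlgEquiv.mul_apply, hfix, ih.1]
    · rw [zpow_add_one, AlgEquiv.mul_apply, hgy, map_mul, ih.1, ih.2, zpow_add_one₀ hc]
      push_cast
      ring
  | pred i ih =>
    have hy : g⁻¹ y = (c : E)⁻¹ * y := by
      apply g.injective
      rw [← AlgEquiv.mul_apply, mul_inv_cancel, map_mul, map_inv₀, hfix, hgy,
        inv_mul_cancel_left₀ hcE]
      rfl
    refine ⟨fun x => ?_, ?_⟩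
    · rw [zpow_sub_one, AlgEquiv.mul_apply, hinv _ (hfix x), ih.1]
    · rw [zpow_sub_one, AlgEquiv.mul_apply, hy, map_mul, map_inv₀, ih.1, ih.2, zpow_sub_one₀ hc]
      push_cast
      ring

open scoped IsMulCommutative in
theorem prod_zpow_apply_eq [IsAbelianGalois F E] {ι : Type*} (s : Finset ι) {g : ι → E ≃ₐ[F] E}
    {c : ι → F'} {y : E} (hfix : ∀ i ∈ s, ∀ x : F', g i x = x) (hc : ∀ i ∈ s, c i ≠ 0)
    (hgy : ∀ i ∈ s, g i y = c i * y) (a : ι → ℤ) :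
    (∀ x : F', (∏ i ∈ s, g i ^ a i) x = x) ∧
      (∏ i ∈ s, g i ^ a i) y = ((∏ i ∈ s, c i ^ a i : F') : E) * y := by
  induction s using Finset.cons_induction with
  | empty => simp
  | cons i s hi ih =>
    have h1 := zpow_apply_eq (hfix i (Finset.mem_cons_self i s)) (hc i (Finset.mem_cons_self i s))
      (hgy i (Finset.mem_cons_self i s)) (a i)
    have h2 := ih (fun j hj => hfix j (Finset.mem_cons_of_mem hj))
      (fun j hj => hc j (Finset.mem_cons_of_mem hj)) fun j hj => hgy j (Finset.mem_cons_of_mem hj)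
    rw [Finset.prod_cons, Finset.prod_cons]
    refine ⟨fun x => ?_, ?_⟩
    · rw [AlgEquiv.mul_apply, h2.1, h1.1]
    · rw [AlgEquiv.mul_apply, h2.2, map_mul, h1.1, h1.2]
      push_cast
      ring

theorem algEquiv_eq_of_adjoin_eq_top {K L : Type*} [Field K] [Field L] [Algebra K L] {y : L}
    (hy : IntermediateField.adjoin K {y} = ⊤) {τ τ' : L ≃ₐ[K] L} (h : τ y = τ' y) : τ = τ' := by
  refine AlgEquiv.ext fun x => ?_
  have hx : x ∈ IntermediateField.adjoin K {y} := hy ▸ trivial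
  induction hx using IntermediateField.adjoin_induction with
  | mem x hx => rw [Set.mem_singleton_iff.1 hx, h]
  | algebraMap x => simp
  | add x y _ _ hx hy => simp [hx, hy]
  | inv x _ hx => simp [hx]
  | mul x y _ _ hx hy => simp [hx, hy]

end ArtinMap

/-- The places in the support of the conorm are grouped by the place below them; the hypothesis on
coefficients encodes ramification index 1. -/
theorem evalAt_conorm {k F L : Type*} [Field k] [Field F] [Field L] [Algebra k F] [Algebra k L]
    [Algebra F L] (D : Divisor k F) (h : L)
    {S : Place k F → Finset (Place k L)} (hS : ∀ P R, R ∈ S P ↔ R.IsAbove P)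
    (hab : ∀ Q : Place k L, ∃ P : Place k F, Q.IsAbove P)
    (hsupp : ∀ (P : Place k F) (Q : Place k L), Q.IsAbove P →
      (Q ∈ (conorm L D).support ↔ P ∈ D.support))
    (hD : ∀ (P : Place k F) (Q : Place k L), Q.IsAbove P → P ∈ D.support → conorm L D Q = D P) :
    evalAt h (conorm L D) =
      ∏ P ∈ D.support, (∏ R ∈ S P, Algebra.norm (algebraicClosure k L) (R.residue h)) ^ D P := by
  classical
  rw [evalAt_eq_prod h (conorm L D) (T := D.support.biUnion S) fun Q hQ => ?_,
    Finset.prod_biUnion fun P _ P' _ hne => ?_]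
  · refine Finset.prod_congr rfl fun P hP => ?_
    rw [← Finset.prod_zpow]
    exact Finset.prod_congr rfl fun R hR => by rw [hD P R ((hS P R).1 hR) hP]
  · exact Finset.disjoint_left.2 fun R hR hR' => hne (((hS P R).1 hR).unique ((hS P' R).1 hR'))
  · obtain ⟨P, hP⟩ := hab Q
    exact Finset.mem_biUnion.2 ⟨P, (hsupp P Q hP).1 hQ, (hS P Q).2 hP⟩

/-- If τ y = c y with c^n = 1, then commutativity shows that τ multiplies the quotient by σ⁻¹(c)^q /
c. This is 1 because σ acts on the constant c as the q-power map. -/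
theorem exists_coe_eq_frobenius_quotient {k F E : Type*} [Field k] [Field F] [Field E] [Algebra k F]
    [Algebra k E] [Algebra F E] [IsScalarTower k F E] [FiniteDimensional F E] [IsAbelianGalois F E]
    {F' : IntermediateField F E} {n : ℕ} (hn : n ≠ 0) (hμ : ∃ ζ : F', IsPrimitiveRoot ζ n)
    {σ : E ≃ₐ[F] E} {φ : F' ≃ₐ[F] F'} (hφ : IsFrobenius k φ) (hσ : ∀ x : F', σ x = φ x)
    {y : E} (hy : y ≠ 0) {f : F'} (hf : (f : E) = y ^ n) :
    ∃ h : F', (h : E) = (σ⁻¹ y) ^ Nat.card k * y⁻¹ := by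
  refine (IsGalois.mem_range_algebraMap_iff_fixed (F := F') _).2 fun τ => ?_
  obtain ⟨c, hc, hcn⟩ := exists_coe_eq_of_pow_eq_one hn hμ (u := τ y * y⁻¹) (by
    have h1 : τ (y ^ n) = y ^ n := by rw [← hf]; exact τ.commutes f
    rw [mul_pow, ← map_pow, h1, inv_pow, mul_inv_cancel₀ (pow_ne_zero n hy)])
  have hcy : τ y = c * y := by rw [hc, inv_mul_cancel_right₀ hy]
  have hc0 : (c : E) ≠ 0 := by
    intro h
    rw [h, zero_mul] at hcy
    exact hy ((map_eq_zero_iff τ τ.injective).1 hcy)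
  have hcomm : τ (σ⁻¹ y) = σ⁻¹ (τ y) := by
    have : τ.restrictScalars F * σ⁻¹ = σ⁻¹ * τ.restrictScalars F :=
      IsMulCommutative.is_comm.comm _ _
    exact DFunLike.congr_fun this y
  have hcq : (σ⁻¹ (c : E)) ^ Nat.card k = c := by
    apply σ.injective
    rw [map_pow, ← AlgEquiv.mul_apply, mul_inv_cancel, hσ, hφ c
      (mem_algebraicClosure_of_pow_eq_one hn hcn)]
    rfl
  rw [map_mul, map_pow, map_inv₀, hcomm, hcy, map_mul, mul_pow, hcq, mul_inv, mul_mul_mul_comm,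
    mul_inv_cancel₀ hc0, one_mul]

end GlobalFunctionField

end

theorem mainTheorem8 {k F E : Type*} [Field k] [Field F] [Field E]
    [Algebra k F] [Algebra k E] [Algebra F E] [IsScalarTower k F E]
    (hF : IsGlobalFunctionField k F)
    [FiniteDimensional F E] [IsAbelianGalois F E]
    (F' : IntermediateField F E) (hF' : IsConstantExtension k F F')
    (n : ℕ) (hn : n.Coprime (Nat.card k)) (hμ : ∃ ζ : F', IsPrimitiveRoot ζ n)
    (m : Divisor k F) (hm : 0 ≤ m) (hunr : IsUnramifiedOutside E m)
    (hcyc : IsCyclic (E ≃ₐ[F'] E)) (hdvd : Module.finrank F' E ∣ n)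
    (D : Divisor k F) (hD : D ∈ divisorsAway m) :
    (∃ σ : E ≃ₐ[F] E, ExtendsFrobenius k F' σ) ∧
    (∃ y : E, IsKummerGenerator F' n m D y) ∧
    ∀ (σ : E ≃ₐ[F] E) (y : E), ExtendsFrobenius k F' σ → IsKummerGenerator F' n m D y →
      ∃ h : F', (h : E) = (σ⁻¹ y) ^ Nat.card k * y⁻¹ ∧ h ≠ 0 ∧
        IsCoprimeTo h (conorm F' D) ∧
        evalAt h (conorm F' D) ^ n = 1 ∧
        ∃ τ : E ≃ₐ[F'] E,
          (∀ τ' : E ≃ₐ[F'] E,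
            τ' y * y⁻¹ = ((evalAt h (conorm F' D) : F') : E) ↔ τ' = τ) ∧
          artinMap E D = τ.restrictScalars F * σ ^ D.deg := by
  classical
  have hfin : Finite k := hF.finite_base
  have hFF : IsFunctionField k F := hF.isFunctionField
  have hFF' : IsFunctionField k F' := .of_finite (L := F)
  have hFE : IsFunctionField k E := .of_finite (L := F)
  have := isScalarTower_base k F'
  have hn0 : n ≠ 0 := by
    -- Zero is coprime to q only if q = 1.
    rintro rfl
    rw [Nat.coprime_zero_left] at hn
    exact Finite.one_lt_card.ne' hn
  refine ⟨exists_extendsFrobenius hF.algebraicClosure_eq_bot F',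
    exists_isKummerGenerator hunr hD hn0 hμ hcyc hdvd, ?_⟩
  rintro σ y ⟨φ, hφ, hσ⟩ ⟨hytop, f, hf, hfsel, hfcop⟩
  have hy : y ≠ 0 := by
    rintro rfl
    rw [zero_pow hn0] at hf
    exact hfsel.1 (Subtype.ext hf)
  obtain ⟨h, hh⟩ := exists_coe_eq_frobenius_quotient hn0 hμ hφ hσ hy hf
  have hh0 : h ≠ 0 := by
    rintro rfl
    exact mul_ne_zero (pow_ne_zero _ ((map_ne_zero_iff _ σ⁻¹.injective).2 hy)) (inv_ne_zero hy)
      hh.symm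
  have hfP : ∀ P ∈ D.support, ∀ Q : Place k F', Q.IsAbove P → Q.ring.valuation f = 1 :=
    fun P hP Q hQ => (Q.ord_eq_zero_iff hfcop.1).1
      (hfcop.2 Q ((mem_support_conorm_iff hunr hD hQ).2 hP))
  have hhP : ∀ P ∈ D.support, ∀ Q : Place k F', Q.IsAbove P → Q.ring.valuation h = 1 := by
    intro P hP Q hQ
    obtain ⟨R, hR⟩ := Q.exists_isAbove (L' := E)
    have hv := valuation_inv_apply_eq_one hn0 hf (hfP P hP) hR hQ
    have hvy : R.ring.valuation y = 1 := hv 1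
    rw [← hR.valuation_eq_one_iff]
    have h1 : algebraMap F' E h = (σ⁻¹ y) ^ Nat.card k * y⁻¹ := hh
    rw [h1, map_mul, map_pow, map_inv₀, hv σ, hvy, one_pow, inv_one, mul_one]
  have hcop : IsCoprimeTo h (conorm F' D) := by
    refine ⟨hh0, fun Q hQ => ?_⟩
    obtain ⟨P, hP⟩ := Q.exists_place_below (L := F)
    exact (Q.ord_eq_zero_iff hh0).2 (hhP P ((mem_support_conorm_iff hunr hD hP).1 hQ) Q hP)
  let S : Place k F → Finset (Place k F') := fun P => (Place.finite_setOf_isAbove F' P).toFinset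
  have hS : ∀ P R, R ∈ S P ↔ R.IsAbove P := fun P R => Set.Finite.mem_toFinset _
  let X : Place k F → algebraicClosure k F' := fun P =>
    ∏ R ∈ S P, Algebra.norm (algebraicClosure k F') (R.residue h)
  have hev : evalAt h (conorm F' D) = ∏ P ∈ D.support, X P ^ D P :=
    evalAt_conorm D h hS (fun Q => Q.exists_place_below)
      (fun P Q hQ => mem_support_conorm_iff hunr hD hQ)
      fun P Q hQ hP => conorm_apply_of_mem_support hunr hD hQ hP
  have hloc := fun P (hP : P ∈ D.support) => exists_artinSymbol_apply_eq hF' hn0 hμ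
    (isArtinSymbol_artinSymbol (L' := E) P) hφ hσ hy hf (hfP P hP) hh (hhP P hP) (hS P)
  have hXn : ∀ P ∈ D.support, X P ^ n = 1 := fun P hP => Subtype.ext (hloc P hP).2.1
  have hX0 : ∀ P ∈ D.support, ((X P : algebraicClosure k F') : F') ≠ 0 := fun P hP h0 => by
    have h1 := hXn P hP
    rw [Subtype.ext (a2 := (0 : algebraicClosure k F')) h0, zero_pow hn0] at h1
    exact zero_ne_one h1
  have hprod := prod_zpow_apply_eq D.support (fun P hP => (hloc P hP).1) hX0
    (fun P hP => (hloc P hP).2.2) D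
  rw [← artinMap_mul_inv_zpow_deg] at hprod
  have hevE : (∏ P ∈ D.support, ((X P : algebraicClosure k F') : F') ^ D P) =
      (evalAt h (conorm F' D) : F') := by
    rw [hev]
    have h1 := map_prod (algebraicClosure k F').val (fun P => X P ^ D P) D.support
    simp only [map_zpow₀] at h1
    exact h1.symm
  rw [hevE] at hprod
  refine ⟨h, hh, hh0, hcop, ?_, ?_⟩
  · rw [hev, ← Finset.prod_pow]
    refine Finset.prod_eq_one fun P hP => ?_
    rw [← zpow_natCast, zpow_comm, zpow_natCast, hXn P hP, one_zpow]
  -- The formula itself defines τ; the product of the local results shows that it fixes `F'` and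
  -- gives its multiplier on y.
  · let τ : E ≃ₐ[F'] E :=
      { artinMap E D * (σ ^ D.deg)⁻¹ with commutes' := hprod.1 }
    have hτ : τ.restrictScalars F = artinMap E D * (σ ^ D.deg)⁻¹ := AlgEquiv.ext fun _ => rfl
    have hτy : τ y = (evalAt h (conorm F' D) : F') * y := hprod.2
    refine ⟨τ, fun τ' => ⟨fun h1 => ?_, ?_⟩, ?_⟩
    · refine algEquiv_eq_of_adjoin_eq_top hytop ?_
      rw [hτy, ← h1, inv_mul_cancel_right₀ hy]
    · rintro rfl
      rw [hτy, mul_inv_cancel_right₀ hy]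
    · rw [hτ, inv_mul_cancel_right]
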